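/- **Setting.** Let $\mathfrak g$ be a finite-dimensional simple Lie algebra with simple roots $\alpha_i$, simple coroots $\alpha_i^\vee$ and fundamental weights $\omega_i$ ($i\in I$), Cartan matrix $C_{i,j}=\langle\alpha_j,\alpha_i^\vee\rangle$, Weyl group $W$ with simple reflections $s_i$, and $Q^+=\bigoplus_i\mathbb Z_{\ge0}\alpha_i$. (Only the root system is used: an irreducible reduced crystallographic root system with a base.) Let $d_i$ be the relatively prime positive integers with $\operatorname{diag}(d_i)\,C$ symmetric, let $q\in\mathbb C^\times$ not be a root of unity, and put $q_i=q^{d_i}$. Let $\mathcal M$ be the multiplicative group of Laurent monomials in the variables $Y_{i,a}$ ($i\in I$, $a\in\mathbb C^\times$), so that $\mathcal Y=\mathbb Z[Y_{i,a}^{\pm1}]$ is its group ring, let $\omega(\prod Y_{i,a}^{u_{i,a}})=\sum u_{i,a}\omega_i$, and let $$A_{i,a}=Y_{i,aq_i^{-1}}Y_{i,aq_i}\Big(\prod_{C_{j,i}=-1}Y_{j,a}\prod_{C_{j,i}=-2}Y_{j,aq^{-1}}Y_{j,aq}\prod_{C_{j,i}=-3}Y_{j,aq^{-2}}Y_{j,a}Y_{j,aq^{2}}\Big)^{-1}.$$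 For $w\in W$ let $\widetilde{\mathcal Y}^w$ be the ring of formal series $\sum_{m\in\mathcal M}a_m m$, $a_m\in\mathbb Z$, such that the weights $w\,\omega(m)$ with $a_m\ne0$ lie in a finite union of cones $\lambda-Q^+$ and, for each weight $\nu$, only finitely many $m$ with $a_m\neq0$ have $\omega(m)=\nu$. It has the topology in which the basic neighbourhoods of $f$ are the sets of all $g$ whose coefficients agree with those of $f$ at all $m$ with $w\,\omega(m)\in C$; here $C$ runs over the sets of weights having, for each weight $\lambda$, only finitely many elements in $\lambda-Q^+$. Put $\Pi=\bigoplus_{w\in W}\widetilde{\mathcal Y}^w$. Define $\Sigma^w_{i,a}\in\widetilde{\mathcal Y}^w$ by $$\Sigma^w_{i,a}=\sum_{k\ge0}\prod_{0<j\le k}A_{i,aq_i^{-2j+2}}^{-1}\ \text{ if } w(\alpha_i)>0,\qquad \Sigma^w_{i,a}=-\sum_{k>0}\prod_{0<j\le k}A_{i,aq_i^{2j}}\ \text{ if } w(\alpha_i)<0 .$$ **Theorem.** Every $\Sigma^w_{i,a}$ is invertible in $\widetilde{\mathcal Y}^w$. For all $i\in I$ and $w\in W$ there is exactly one continuous ring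 homomorphism $\Theta_i^w:\widetilde{\mathcal Y}^w\to\widetilde{\mathcal Y}^{ws_i}$ such that, for all $a\in\mathbb C^\times$, $\Theta_i^w(Y_{j,a})=Y_{j,a}$ for $j\ne i$ and $$\Theta_i^w(Y_{i,a})=Y_{i,a}A_{i,aq_i^{-1}}^{-1}\,\frac{\Sigma^{ws_i}_{i,aq_i^{-3}}}{\Sigma^{ws_i}_{i,aq_i^{-1}}}.$$ Let $\Theta_i:\Pi\to\Pi$ be the continuous ring homomorphism that is the direct sum of the $\Theta_i^w$ over all $w\in W$. The homomorphisms $\Theta_i$, $i\in I$, generate an action of $W$ on $\Pi$: there is a unique group homomorphism from $W$ to the group of ring automorphisms of $\Pi$ that sends $s_i$ to $\Theta_i$ for every $i\in I$. -/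

import Mathlib

noncomputable section

namespace QCharacter

open scoped Classical

set_option linter.unusedSectionVars false

/-!
Conventions. `P` is a root system with root space `V` and coroot space `V'`, `b` is a base of `P`,
the index set `I` is `b.support`, and `W` is `P.weylGroup`. The multiplicative group of Laurent
monomials in the variables `Y_{i,a}` is written additively, as a group of exponent vectors.
-/

variable {ι K V V' : Type*} [Field K] [CharZero K] [AddCommGroup V] [Module K V]
  [AddCommGroup V'] [Module K V'] {P : RootPairing ι K V V'}

/-! ### Cartan matrix, weights, dominance order -/

section Weights

variable (b : P.Base)

/-- The Cartan matrix in Kac's convention: `C_{i,j} = ⟨α_j, α_i^∨⟩`. -/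
def cartan [P.IsCrystallographic] (i j : b.support) : ℤ := P.pairingIn ℤ j i

/-- `d` is the family of relatively prime positive integers with `diag(d) * C` symmetric. -/
structure IsSymmetrizer [P.IsCrystallographic] (d : b.support → ℕ) : Prop where
  pos : ∀ i, 0 < d i
  symm : ∀ i j, (d i : ℤ) * cartan b i j = (d j : ℤ) * cartan b j i
  coprime : Finset.univ.gcd d = 1

/-- `n ↦ ∑ i, n_i α_i`. -/
def rootSum : (b.support → ℕ) →+ V where
  toFun n := ∑ i, n i • P.root i
  map_zero' := by simp
  map_add' m n := by simp [add_smul, Finset.sum_add_distrib]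

/-- The cone `Q⁺ = ⨁ i, ℤ_{≥ 0} α_i`. In the dominance order, `μ ≤ ν` means `ν - μ ∈ Q⁺`. -/
def posCone : AddSubmonoid V := AddMonoidHom.mrange (rootSum b)

/-- The fundamental weight `ω_i`, the basis of `V` dual to the simple coroots. -/
def fundamentalWeight [P.IsRootSystem] (i : b.support) : V :=
  P.toPerfPair.symm (b.toCoweightBasis.coord i)

/-- The simple reflection `s_i` as an element of the Weyl group. -/
def simpleReflection (i : b.support) : P.weylGroup := RootPairing.weylGroup.ofIdx P i

/-- Laurent monomials in the `Y_{i,a}`, written additively. -/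
abbrev Monomial : Type _ := (b.support × ℂˣ) →₀ ℤ

variable {b} in
/-- The monomial `Y_{i,a}`. -/
def Y (i : b.support) (a : ℂˣ) : Monomial b := Finsupp.single (i, a) 1

/-- The weight of a monomial: `ω(∏ Y_{i,a}^{u_{i,a}}) = ∑ u_{i,a} ω_i`. -/
def weight [P.IsRootSystem] : Monomial b →+ V :=
  Finsupp.liftAddHom fun p => zmultiplesHom V (fundamentalWeight b p.1)

/-- The monomial `A_{i,a}` (written additively), with `q_i = q ^ d_i`. -/
def A [P.IsCrystallographic] (d : b.support → ℕ) (q : ℂˣ) (i : b.support) (a : ℂˣ) :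
    Monomial b :=
  Y i (a * (q ^ d i)⁻¹) + Y i (a * q ^ d i)
    - ∑ j with cartan b j i = -1, Y j a
    - ∑ j with cartan b j i = -2, (Y j (a * q⁻¹) + Y j (a * q))
    - ∑ j with cartan b j i = -3, (Y j (a * q⁻¹ ^ 2) + Y j a + Y j (a * q ^ 2))

end Weights

/-! ### Elementary facts -/

section Facts

variable (b : P.Base)

lemma rootSum_injective : Function.Injective (rootSum b) := by
  intro m n h
  have hli : LinearIndependent K (fun i : b.support => P.root i) := b.linearIndepOn_root
  rw [Fintype.linearIndependent_iff] at hli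
  have h' : ∑ i, ((m i : K) - (n i : K)) • P.root (i : ι) = 0 := by
    have : ∑ i, m i • P.root (i : ι) = ∑ i, n i • P.root (i : ι) := h
    simp only [sub_smul, Finset.sum_sub_distrib, Nat.cast_smul_eq_nsmul, this, sub_self]
  funext i
  exact_mod_cast sub_eq_zero.1 (hli _ h' i)

lemma posCone_antisymm {x : V} (hx : x ∈ posCone b) (hx' : -x ∈ posCone b) : x = 0 := by
  obtain ⟨m, rfl⟩ := hx
  obtain ⟨n, hn⟩ := hx'
  have : rootSum b (m + n) = rootSum b 0 := by rw [map_add, hn]; simp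
  have h := rootSum_injective b this
  have : m = 0 := by
    funext i
    have := congrFun h i
    simp only [Pi.add_apply, Pi.zero_apply] at this
    simp only [Pi.zero_apply]
    omega
  simp [this]

lemma finite_posCone_interval (c : V) : {x | x ∈ posCone b ∧ c - x ∈ posCone b}.Finite := by
  by_cases hc : ∃ n, rootSum b n = c
  · obtain ⟨n, rfl⟩ := hc
    refine ((Set.finite_Iic n).image (rootSum b)).subset ?_
    rintro _ ⟨⟨k, rfl⟩, ⟨l, hl⟩⟩
    refine ⟨k, ?_, rfl⟩
    have : rootSum b (k + l) = rootSum b n := by rw [map_add, hl]; abel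
    rw [← rootSum_injective b this]
    intro i
    simp
  · convert Set.finite_empty
    rw [Set.eq_empty_iff_forall_notMem]
    rintro _ ⟨⟨k, rfl⟩, ⟨l, hl⟩⟩
    exact hc ⟨k + l, by rw [map_add, hl]; abel⟩

lemma closure_le_posCone :
    AddSubmonoid.closure (P.root '' b.support) ≤ posCone b := by
  rw [AddSubmonoid.closure_le]
  rintro _ ⟨i, hi, rfl⟩
  refine ⟨Pi.single ⟨i, hi⟩ 1, ?_⟩
  change ∑ j : b.support, (Pi.single ⟨i, hi⟩ 1 : b.support → ℕ) j • P.root j = P.root i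
  rw [Finset.sum_eq_single ⟨i, hi⟩] <;> simp +contextual

lemma neg_smul_root_mem (w : P.weylGroup) (i : ι) (h : w • P.root i ∉ posCone b) :
    -(w • P.root i) ∈ posCone b := by
  rw [RootPairing.weylGroup_apply_root] at h ⊢
  exact closure_le_posCone b
    ((b.root_mem_or_neg_mem _).resolve_left fun h' => h (closure_le_posCone b h'))

variable [P.IsRootSystem]

lemma pairing_fundamentalWeight (i j : b.support) :
    P.toLinearMap (fundamentalWeight b i) (P.coroot j) = if i = j then 1 else 0 := by
  have h : P.toPerfPair (fundamentalWeight b i) = b.toCoweightBasis.coord i := by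
    simp [fundamentalWeight]
  have h2 := LinearMap.congr_fun h (P.coroot j)
  rw [LinearMap.toPerfPair_apply] at h2
  rw [h2]
  simp [Finsupp.single_apply, eq_comm]

lemma eq_of_pairing_eq {x y : V}
    (h : ∀ j : b.support, P.toLinearMap x (P.coroot j) = P.toLinearMap y (P.coroot j)) :
    x = y := by
  apply P.toPerfPair.injective
  refine b.toCoweightBasis.ext fun j => ?_
  simpa using h j

@[simp] lemma weight_Y (i : b.support) (a : ℂˣ) : weight b (Y i a) = fundamentalWeight b i := by
  simp [weight, Y]

lemma weight_A [P.IsCrystallographic] [Finite ι] (d : b.support → ℕ) (q : ℂˣ)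
    (i : b.support) (a : ℂˣ) : weight b (A b d q i a) = P.root i := by
  refine eq_of_pairing_eq b fun k => ?_
  have hk : P.toLinearMap (P.root i) (P.coroot k) = ((cartan b k i : ℤ) : K) := by
    have := P.algebraMap_pairingIn ℤ i k
    simpa [cartan] using this.symm
  rw [hk]
  simp only [A, map_add, map_sub, map_sum, weight_Y, LinearMap.add_apply, LinearMap.sub_apply,
    LinearMap.sum_apply, pairing_fundamentalWeight, Finset.sum_ite_eq', Finset.sum_add_distrib,
    Finset.mem_filter, Finset.mem_univ, true_and]
  rcases eq_or_ne i k with rfl | hik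
  · have : cartan b i i = 2 := b.cartanMatrix_apply_same i
    simp [this]; norm_num
  · have := b.cartanMatrix_mem_of_ne hik
    change cartan b k i ∈ _ at this
    simp only [Set.mem_insert_iff, Set.mem_singleton_iff] at this
    rcases this with h | h | h | h <;> simp [h, hik] <;> norm_num

end Facts

/-! ### The completions -/

section Completion

variable (b : P.Base) [P.IsRootSystem]

/-- The condition on the support `S` of a formal series in the `w`-completion: the weights
`w • ω(m)`, `m ∈ S`, lie in a finite union of cones `λ - Q⁺`, and every weight is the weight of
only finitely many `m ∈ S`. (As `w • ω(m)` is an integral weight, a `λ` with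
`λ - w • ω(m) ∈ Q⁺` is automatically integral.) -/
def IsAdmissible (w : P.weylGroup) (S : Set (Monomial b)) : Prop :=
  (∃ Λ : Finset V, ∀ m ∈ S, ∃ l ∈ Λ, l - w • weight b m ∈ posCone b) ∧
    ∀ ν : V, {m ∈ S | weight b m = ν}.Finite

/-- The monomials, with the (reversed) order: `m < m'` if `w • ω(m')` is strictly below
`w • ω(m)` in the dominance order. -/
def OrdMonomial (_w : P.weylGroup) : Type _ := Monomial b

variable {b} (w : P.weylGroup)

instance : AddCommGroup (OrdMonomial b w) := inferInstanceAs (AddCommGroup (Monomial b))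

/-- The dominance relation twisted by `w`, on monomials. -/
instance : PartialOrder (OrdMonomial b w) where
  le m m' := m = m' ∨ (weight b m ≠ weight b m' ∧ w • weight b m - w • weight b m' ∈ posCone b)
  le_refl m := Or.inl rfl
  le_trans m m' m'' h h' := by
    rcases h with rfl | ⟨h1, h2⟩
    · exact h'
    rcases h' with rfl | ⟨h3, h4⟩
    · exact Or.inr ⟨h1, h2⟩
    refine Or.inr ⟨fun h => h1 ?_, ?_⟩
    · have : w • weight b m - w • weight b m' = 0 := by
        refine posCone_antisymm b h2 ?_
        rw [h]; simpa using h4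
      exact smul_left_cancel w (sub_eq_zero.1 this)
    · simpa using add_mem h2 h4
  le_antisymm m m' h h' := by
    rcases h with h | ⟨h1, h2⟩
    · exact h
    rcases h' with h' | ⟨h3, h4⟩
    · exact h'.symm
    exact absurd (smul_left_cancel w (sub_eq_zero.1 (posCone_antisymm b h2 (by simpa using h4)))) h1

lemma ordMonomial_le_iff {m m' : OrdMonomial b w} : m ≤ m' ↔ m = m' ∨
    (weight b m ≠ weight b m' ∧ w • weight b m - w • weight b m' ∈ posCone b) := Iff.rfl

instance : IsOrderedCancelAddMonoid (OrdMonomial b w) :=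
  have key : ∀ c m m' : OrdMonomial b w, c + m ≤ c + m' ↔ m ≤ m' := by
    intro c m m'
    have h : ∀ x : OrdMonomial b w, weight b (c + x) = weight b c + weight b x :=
      fun x => map_add (weight b) c x
    rw [ordMonomial_le_iff, ordMonomial_le_iff, h, h]
    simp
  { add_le_add_left := fun m m' h c => by
      rw [add_comm m c, add_comm m' c]; exact (key c m m').2 h
    le_of_add_le_add_left := fun c m m' h => (key c m m').1 h }

/-- Admissible sets are partially well-ordered. -/
lemma IsAdmissible.isPWO {S : Set (Monomial b)} (h : IsAdmissible b w S) :
    Set.IsPWO (α := OrdMonomial b w) S := by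
  obtain ⟨⟨Λ, hΛ⟩, hfin⟩ := h
  refine Set.partiallyWellOrderedOn_iff_exists_lt.2 fun f hf => ?_
  have hex : ∀ n, ∃ (l : Λ) (k : b.support → ℕ), rootSum b k = (l : V) - w • weight b (f n) := by
    intro n
    obtain ⟨l, hl, k, hk⟩ := hΛ (f n) (hf n)
    exact ⟨⟨l, hl⟩, k, hk⟩
  choose l k hlk using hex
  have hwqo : WellQuasiOrdered
      (fun x y : Λ × (b.support → ℕ) => x.1 = y.1 ∧ x.2 ≤ y.2) :=
    (Finite.wellQuasiOrdered (α := Λ) (· = ·)).prod (wellQuasiOrdered_le)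
  have : IsPreorder (Λ × (b.support → ℕ)) (fun x y => x.1 = y.1 ∧ x.2 ≤ y.2) :=
    { refl := fun x => ⟨rfl, le_rfl⟩
      trans := fun x y z h h' => ⟨h.1.trans h'.1, h.2.trans h'.2⟩ }
  obtain ⟨g, hg⟩ := hwqo.exists_monotone_subseq (fun n => (l n, k n))
  have hdiff : ∀ m n, m ≤ n →
      w • weight b (f (g m)) - w • weight b (f (g n)) ∈ posCone b := by
    intro m n hmn
    obtain ⟨h1, h2⟩ := hg m n hmn
    refine ⟨k (g n) - k (g m), ?_⟩
    have hadd : rootSum b (k (g n) - k (g m)) + rootSum b (k (g m)) = rootSum b (k (g n)) := by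
      rw [← map_add, tsub_add_cancel_of_le h2]
    have h1' : l (g m) = l (g n) := h1
    rw [eq_sub_of_add_eq hadd, hlk, hlk, h1']
    abel
  by_cases hne : ∃ n, 0 < n ∧ weight b (f (g 0)) ≠ weight b (f (g n))
  · obtain ⟨n, hn, hne⟩ := hne
    exact ⟨g 0, g n, g.strictMono hn, Or.inr ⟨hne, hdiff 0 n (Nat.zero_le _)⟩⟩
  · push Not at hne
    have hmem : ∀ n : ℕ, f (g (n + 1)) ∈ {m ∈ S | weight b m = weight b (f (g 0))} :=
      fun n => ⟨hf _, (hne _ n.succ_pos).symm⟩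
    obtain ⟨m, n, hmn, he⟩ := (hfin _).exists_lt_map_eq_of_forall_mem hmem
    exact ⟨g (m + 1), g (n + 1), g.strictMono (by omega), Or.inl he⟩

lemma IsAdmissible.mono {S T : Set (Monomial b)} (hT : IsAdmissible b w T) (h : S ⊆ T) :
    IsAdmissible b w S :=
  ⟨hT.1.imp fun _ hΛ m hm => hΛ m (h hm), fun ν => (hT.2 ν).subset fun _ hm => ⟨h hm.1, hm.2⟩⟩

lemma IsAdmissible.union {S T : Set (Monomial b)} (hS : IsAdmissible b w S)
    (hT : IsAdmissible b w T) : IsAdmissible b w (S ∪ T) := by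
  obtain ⟨⟨Λ, hΛ⟩, h1⟩ := hS
  obtain ⟨⟨Λ', hΛ'⟩, h2⟩ := hT
  refine ⟨⟨Λ ∪ Λ', ?_⟩, fun ν => ((h1 ν).union (h2 ν)).subset ?_⟩
  · rintro m (hm | hm)
    · obtain ⟨l, hl, h⟩ := hΛ m hm
      exact ⟨l, Finset.mem_union_left _ hl, h⟩
    · obtain ⟨l, hl, h⟩ := hΛ' m hm
      exact ⟨l, Finset.mem_union_right _ hl, h⟩
  · rintro m ⟨hm | hm, h⟩
    · exact Or.inl ⟨hm, h⟩
    · exact Or.inr ⟨hm, h⟩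

lemma isAdmissible_singleton (m : Monomial b) : IsAdmissible b w {m} :=
  ⟨⟨{w • weight b m}, by rintro _ rfl; exact ⟨_, Finset.mem_singleton_self _, by simp⟩⟩,
    fun _ => (Set.finite_singleton m).subset fun _ h => h.1⟩

lemma IsAdmissible.add {S T : Set (Monomial b)} (hS : IsAdmissible b w S)
    (hT : IsAdmissible b w T) : IsAdmissible b w (Set.image2 (· + ·) S T) := by
  obtain ⟨⟨Λ, hΛ⟩, h1⟩ := hS
  obtain ⟨⟨Λ', hΛ'⟩, h2⟩ := hT
  refine ⟨⟨Finset.image₂ (· + ·) Λ Λ', ?_⟩, fun ν => ?_⟩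
  · rintro _ ⟨m, hm, m', hm', rfl⟩
    obtain ⟨l, hl, h⟩ := hΛ m hm
    obtain ⟨l', hl', h'⟩ := hΛ' m' hm'
    refine ⟨l + l', Finset.mem_image₂_of_mem hl hl', ?_⟩
    rw [map_add, smul_add, add_sub_add_comm]
    exact add_mem h h'
  · have hF : (⋃ p ∈ Λ ×ˢ Λ', (fun x => w⁻¹ • (p.1 - x)) ''
        {x | x ∈ posCone b ∧ p.1 + p.2 - w • ν - x ∈ posCone b}).Finite :=
      Set.Finite.biUnion (Finset.finite_toSet _) fun p _ =>
        (finite_posCone_interval b _).image _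
    have hU : (⋃ μ ∈ (⋃ p ∈ Λ ×ˢ Λ', (fun x => w⁻¹ • (p.1 - x)) ''
        {x | x ∈ posCone b ∧ p.1 + p.2 - w • ν - x ∈ posCone b}),
        Set.image2 (· + ·) {m ∈ S | weight b m = μ} {m ∈ T | weight b m = ν - μ}).Finite :=
      hF.biUnion fun μ _ => (h1 μ).image2 _ (h2 (ν - μ))
    refine hU.subset ?_
    rintro _ ⟨⟨m, hm, m', hm', rfl⟩, hν⟩
    obtain ⟨l, hl, h⟩ := hΛ m hm
    obtain ⟨l', hl', h'⟩ := hΛ' m' hm'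
    have hν' : weight b m + weight b m' = ν := by rw [← hν]; exact (map_add _ _ _).symm
    refine Set.mem_biUnion (x := weight b m) ?_
      ⟨m, ⟨hm, rfl⟩, m', ⟨hm', eq_sub_of_add_eq' hν'⟩, rfl⟩
    refine Set.mem_biUnion (x := (l, l')) (Finset.mem_product.2 ⟨hl, hl'⟩)
      ⟨l - w • weight b m, ⟨h, ?_⟩, by simp⟩
    rw [← hν', smul_add]
    convert h' using 1
    abel

variable (b) in
/-- The subring of series with admissible support in the ring of Hahn series on the monomials.
By `IsAdmissible.isPWO` its elements are all the families of integer coefficients with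
admissible support, and the product is the usual product of series. -/
def completionSubring : Subring (HahnSeries (OrdMonomial b w) ℤ) where
  carrier := {f | IsAdmissible b w f.support}
  mul_mem' {f g} hf hg := (hf.add w hg).mono w (HahnSeries.support_mul_subset)
  one_mem' := (isAdmissible_singleton w 0).mono w
    (by rw [HahnSeries.support_one]; exact subset_rfl)
  add_mem' {f g} hf hg := (hf.union w hg).mono w (HahnSeries.support_add_subset _ _)
  zero_mem' := (isAdmissible_singleton w 0).mono w
    (by rw [HahnSeries.support_zero]; exact Set.empty_subset _)
  neg_mem' {f} hf := by
    refine hf.mono w fun m hm => ?_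
    simpa using hm

variable (b) in
/-- The completion `𝒴̃^w`: the ring of formal series `∑ a_m m` with integer coefficients and
admissible support. -/
def Completion : Type _ := completionSubring b w

instance : CommRing (Completion b w) := inferInstanceAs (CommRing (completionSubring b w))

variable {w} in
/-- The coefficient of the monomial `m` in a series. -/
def Completion.coeff (f : Completion b w) (m : Monomial b) : ℤ :=
  HahnSeries.coeff (Γ := OrdMonomial b w) f.1 m

/-- The series with given coefficients. -/
def Completion.ofCoeff (c : Monomial b → ℤ) (hc : IsAdmissible b w (Function.support c)) :
    Completion b w :=
  ⟨{ coeff := c, isPWO_support' := hc.isPWO w }, hc⟩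

/-- The image in `𝒴̃^w` of a monomial. -/
def Completion.monomial (m : Monomial b) : Completion b w :=
  Completion.ofCoeff w (fun m' => if m' = m then 1 else 0)
    ((isAdmissible_singleton w m).mono w fun m' hm' => by
      by_contra h
      exact hm' (if_neg h))

/-- The topology on `𝒴̃^w` defined by the dominance order. The basic neighbourhoods of `f` are
indexed by the sets `C` of weights that have finitely many elements below any given weight; the
neighbourhood of `f` given by `C` consists of all `g` whose coefficients agree with those of `f`
at all monomials `m` with `w • ω(m) ∈ C`. -/
instance : TopologicalSpace (Completion b w) where
  IsOpen U := ∀ f ∈ U, ∃ C : Set V, (∀ l : V, {ν ∈ C | l - ν ∈ posCone b}.Finite) ∧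
    ∀ g : Completion b w, (∀ m, w • weight b m ∈ C → g.coeff m = f.coeff m) → g ∈ U
  isOpen_univ f _ := ⟨∅, by simp, by simp⟩
  isOpen_inter U U' h h' f hf := by
    obtain ⟨C, hC, hU⟩ := h f hf.1
    obtain ⟨C', hC', hU'⟩ := h' f hf.2
    refine ⟨C ∪ C', fun l => ((hC l).union (hC' l)).subset ?_, fun g hg =>
      ⟨hU g fun m hm => hg m (Or.inl hm), hU' g fun m hm => hg m (Or.inr hm)⟩⟩
    rintro ν ⟨hν | hν, h⟩
    · exact Or.inl ⟨hν, h⟩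
    · exact Or.inr ⟨hν, h⟩
  isOpen_sUnion 𝒰 h f hf := by
    obtain ⟨U, hU, hfU⟩ := hf
    obtain ⟨C, hC, hU'⟩ := h U hU f hfU
    exact ⟨C, hC, fun g hg => ⟨U, hU, hU' g hg⟩⟩

variable (b) in
/-- The ring `Π`, the direct sum of the completions over the (finite) Weyl group. -/
abbrev BigPi : Type _ := ∀ w : P.weylGroup, Completion b w

end Completion

/-! ### The solutions of the `q`-difference equations and the operators -/

section Theta

variable (b : P.Base) [P.IsRootSystem] [P.IsCrystallographic] [Finite ι] (d : b.support → ℕ)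
  (q : ℂˣ) (w : P.weylGroup) (i : b.support)

/-- The coefficients of `Σ⁺_{i,a} = ∑_{k ≥ 0} ∏_{0 < j ≤ k} A_{i, a q_i^{-2j+2}}⁻¹`. -/
def sigmaPosCoeff (a : ℂˣ) (m : Monomial b) : ℤ :=
  if ∃ k : ℕ, m = -∑ j ∈ Finset.Icc 1 k, A b d q i (a * (q ^ d i) ^ (-2 * (j : ℤ) + 2))
  then 1 else 0

/-- The coefficients of `Σ⁻_{i,a} = -∑_{k > 0} ∏_{0 < j ≤ k} A_{i, a q_i^{2j}}`. -/
def sigmaNegCoeff (a : ℂˣ) (m : Monomial b) : ℤ :=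
  if ∃ k : ℕ, 0 < k ∧ m = ∑ j ∈ Finset.Icc 1 k, A b d q i (a * (q ^ d i) ^ (2 * (j : ℤ)))
  then -1 else 0

lemma isAdmissible_of_ray (x : V) (hx : x ≠ 0) (hx' : -(w • x) ∈ posCone b)
    (m : ℕ → Monomial b) (hm : ∀ k, weight b (m k) = k • x) :
    IsAdmissible b w (Set.range m) := by
  have hw : ∀ k, w • weight b (m k) = k • (w • x) := by
    intro k
    rw [hm]
    exact map_nsmul (DistribSMul.toAddMonoidHom V w) k x
  refine ⟨⟨{0}, ?_⟩, fun ν => Set.Subsingleton.finite ?_⟩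
  · rintro _ ⟨k, rfl⟩
    refine ⟨0, Finset.mem_singleton_self _, ?_⟩
    rw [hw, zero_sub, ← smul_neg]
    exact nsmul_mem hx' k
  · rintro _ ⟨⟨k, rfl⟩, hk⟩ _ ⟨⟨l, rfl⟩, hl⟩
    rw [hm] at hk hl
    have h : ((k : K) - l) • x = 0 := by
      rw [sub_smul, Nat.cast_smul_eq_nsmul, Nat.cast_smul_eq_nsmul, hk, hl, sub_self]
    have hkl : (k : K) = l := sub_eq_zero.1 ((smul_eq_zero.1 h).resolve_right hx)
    rw [Nat.cast_injective hkl]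

lemma isAdmissible_sigmaPos (a : ℂˣ) (h : w • P.root i ∈ posCone b) :
    IsAdmissible b w (Function.support (sigmaPosCoeff b d q i a)) := by
  refine (isAdmissible_of_ray b w (-P.root i) (neg_ne_zero.2 (P.ne_zero i))
    (by simpa using h) (fun k => -∑ j ∈ Finset.Icc 1 k,
      A b d q i (a * (q ^ d i) ^ (-2 * (j : ℤ) + 2))) ?_).mono w ?_
  · intro k
    simp [weight_A]
  · intro m hm
    by_contra hm'
    exact hm (if_neg fun ⟨k, hk⟩ => hm' ⟨k, hk.symm⟩)

lemma isAdmissible_sigmaNeg (a : ℂˣ) (h : w • P.root i ∉ posCone b) :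
    IsAdmissible b w (Function.support (sigmaNegCoeff b d q i a)) := by
  refine (isAdmissible_of_ray b w (P.root i) (P.ne_zero i)
    (neg_smul_root_mem b w i h) (fun k => ∑ j ∈ Finset.Icc 1 k,
      A b d q i (a * (q ^ d i) ^ (2 * (j : ℤ)))) ?_).mono w ?_
  · intro k
    simp [weight_A]
  · intro m hm
    by_contra hm'
    exact hm (if_neg fun ⟨k, _, hk⟩ => hm' ⟨k, hk.symm⟩)

variable {b}

/-- `Σ^w_{i,a}` is `Σ⁺_{i,a}` if `w(α_i)` is a positive root, and `Σ⁻_{i,a}` otherwise. -/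
def Sigma (a : ℂˣ) : Completion b w :=
  if h : w • P.root i ∈ posCone b then
    Completion.ofCoeff w (sigmaPosCoeff b d q i a) (isAdmissible_sigmaPos b d q w i a h)
  else
    Completion.ofCoeff w (sigmaNegCoeff b d q i a) (isAdmissible_sigmaNeg b d q w i a h)

/-- `T` is a continuous ring homomorphism `𝒴̃^w → 𝒴̃^{w s_i}` that extends the homomorphism
`Θ_i^w` from Laurent polynomials:
`Y_{j,a} ↦ Y_{j,a}` for `j ≠ i` and
`Y_{i,a} ↦ Y_{i,a} A_{i,a q_i⁻¹}⁻¹ Σ_{i,a q_i⁻³} / Σ_{i,a q_i⁻¹}`, with `Σ = Σ^{w s_i}`. -/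
structure IsThetaComponent
    (T : Completion b w →+* Completion b (w * simpleReflection b i)) : Prop where
  continuous : Continuous T
  map_of_ne : ∀ j, j ≠ i → ∀ a, T (Completion.monomial w (Y j a)) = Completion.monomial _ (Y j a)
  map_self : ∀ a, T (Completion.monomial w (Y i a)) =
    Completion.monomial _ (Y i a - A b d q i (a * (q ^ d i)⁻¹)) *
      Sigma d q (w * simpleReflection b i) i (a * (q ^ d i)⁻¹ ^ 3) *
      Ring.inverse (Sigma d q (w * simpleReflection b i) i (a * (q ^ d i)⁻¹))

/-- `T` is the direct sum over `w ∈ W` of the continuous homomorphisms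
`Θ_i^w : 𝒴̃^w → 𝒴̃^{w s_i}`. -/
def IsTheta (T : BigPi b →+* BigPi b) : Prop :=
  ∀ w : P.weylGroup, ∃ Tw : Completion b w →+* Completion b (w * simpleReflection b i),
    IsThetaComponent d q w i Tw ∧ ∀ f : BigPi b, T f (w * simpleReflection b i) = Tw (f w)

end Theta

end QCharacter

end

/-! The operators are pinned down by the Laurent polynomials they fix. On a monomial $m$, $\Theta_i$
gives an invertible series in $\widetilde{\mathcal Y}^{ws_i}$ whose leading twisted weight is
$w\,\omega(m)$: the monomial $Y_{i,a}A_{i,aq_i^{-1}}^{-1}$ has weight $s_i\omega_i$, and the two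
series $\Sigma$ have the same leading weight, so their quotient contributes nothing. Hence
$\Theta_i$ does not raise twisted weights and extends by continuity from Laurent polynomials
(`extend`). The functional equation $\Sigma_{i,a}=1+A_{i,a}^{-1}\Sigma_{i,aq_i^{-2}}$ (`Sigma_eq`),
common to both expansions, shows that $\Theta_i$ fixes $Y_{i,a}(1+A_{i,aq_i}^{-1})$
(`Y_add_mem_Inv`) as well as all $Y_{j,a}$ with $j\ne i$.

Rigidity (`ringHom_eq_of_leading`): two continuous homomorphisms that do not raise weights coincide
once they agree on Laurent polynomials whose leading monomials generate the group of monomials,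
because agreement then propagates to every depth below the leading weight. Applied to the invariants
above it gives $\Theta_i^2=1$ (`theta_comp_theta`).

For the braid relations, rank two $q$-characters of fundamental representations supply Laurent
polynomials with highest monomial $Y_{i,a}$ that are fixed by both $\Theta_i$ and $\Theta_j$
(`hasInvariant`). Let $u$ send $\alpha_i$ and $\alpha_j$ to negative roots. The two alternating
descending paths from $u$ end at the same $v$, with $v\alpha_i,v\alpha_j>0$. In $\widetilde{\mathcal
Y}^v$ these invariants have leading monomial $Y_{i,a}$, so rigidity identifies the inverses of the
two composites (`exists_diamond`).

The passage to all of $W$ avoids a presentation of $W$. Descents terminate, so the diamond property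
gives uniqueness of the composite along maximal descending paths, as in Newman's lemma
(`isNormalForm_unique`). These composites identify every $\widetilde{\mathcal Y}^u$ with one fixed
ring, compatibly with all $\Theta_i$ (`exists_trivialization`). In this trivialization $\Theta_i$ is
right translation by $s_i$ on functions from $W$ to that ring, so the action is visible; it is
unique because the $s_i$ generate $W$. -/

noncomputable section

namespace QCharacter

open scoped Classical

set_option linter.unusedSectionVars false

variable {ι K V V' : Type*} [Field K] [CharZero K] [AddCommGroup V] [Module K V]
  [AddCommGroup V'] [Module K V'] {P : RootPairing ι K V V'}

/-! ### Depth in the dominance order -/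

section Depth

variable (b : P.Base)

/-- The elements of the cone `Q⁺` of height at least `n`. -/
def Deep (n : ℕ) (x : V) : Prop := ∃ k : b.support → ℕ, rootSum b k = x ∧ n ≤ ∑ i, k i

variable {b}

lemma deep_zero_iff {x : V} : Deep b 0 x ↔ x ∈ posCone b :=
  ⟨fun ⟨k, hk, _⟩ => ⟨k, hk⟩, fun ⟨k, hk⟩ => ⟨k, hk, Nat.zero_le _⟩⟩

lemma Deep.mono {n n' : ℕ} {x : V} (h : Deep b n x) (hn : n' ≤ n) : Deep b n' x :=
  let ⟨k, hk, hkn⟩ := h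
  ⟨k, hk, hn.trans hkn⟩

lemma Deep.mem {n : ℕ} {x : V} (h : Deep b n x) : x ∈ posCone b :=
  deep_zero_iff.1 (h.mono (Nat.zero_le n))

lemma Deep.add {n n' : ℕ} {x y : V} (h : Deep b n x) (h' : Deep b n' y) :
    Deep b (n + n') (x + y) := by
  obtain ⟨k, rfl, hk⟩ := h
  obtain ⟨k', rfl, hk'⟩ := h'
  refine ⟨k + k', map_add _ _ _, ?_⟩
  simp only [Pi.add_apply, Finset.sum_add_distrib]
  omega

lemma deep_one_of_mem {x : V} (h : x ∈ posCone b) (hx : x ≠ 0) : Deep b 1 x := by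
  obtain ⟨k, rfl⟩ := h
  refine ⟨k, rfl, Nat.one_le_iff_ne_zero.2 fun h0 => hx ?_⟩
  have : k = 0 := by
    funext i
    exact Finset.sum_eq_zero_iff.1 h0 i (Finset.mem_univ i)
  simp [this]

lemma exists_not_deep (x : V) : ∃ n, ¬ Deep b n x := by
  by_cases hx : x ∈ posCone b
  · obtain ⟨k, rfl⟩ := hx
    refine ⟨∑ i, k i + 1, fun ⟨l, hl, h⟩ => ?_⟩
    rw [rootSum_injective b hl] at h
    omega
  · exact ⟨0, fun h => hx h.mem⟩

end Depth

/-! ### Coefficients -/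

section Coefficients

variable {b : P.Base} [P.IsRootSystem] (w : P.weylGroup)

variable (b) in
/-- The weight of a monomial twisted by `w`. -/
def twt : Monomial b →+ V := (DistribSMul.toAddMonoidHom V w).comp (weight b)

lemma twt_apply (m : Monomial b) : twt b w m = w • weight b m := rfl

namespace Completion

variable {w}

@[ext] lemma ext {f g : Completion b w} (h : ∀ m, f.coeff m = g.coeff m) : f = g :=
  Subtype.ext (HahnSeries.ext (funext h))

@[simp] lemma coeff_add (f g : Completion b w) (m : Monomial b) :
    (f + g).coeff m = f.coeff m + g.coeff m := rfl

@[simp] lemma coeff_sub (f g : Completion b w) (m : Monomial b) :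
    (f - g).coeff m = f.coeff m - g.coeff m := rfl

@[simp] lemma coeff_neg (f : Completion b w) (m : Monomial b) :
    (-f).coeff m = -f.coeff m := rfl

@[simp] lemma coeff_zero (m : Monomial b) : (0 : Completion b w).coeff m = 0 := rfl

@[simp] lemma coeff_ofCoeff (c : Monomial b → ℤ) (hc) (m : Monomial b) :
    (ofCoeff w c hc).coeff m = c m := rfl

lemma coeff_monomial (m m' : Monomial b) :
    (monomial w m).coeff m' = if m' = m then 1 else 0 := rfl

lemma admissible (f : Completion b w) : IsAdmissible b w (Function.support f.coeff) := f.2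

variable (b w) in
/-- The coefficient of a monomial, as an additive map. -/
def coeffHom (m : Monomial b) : Completion b w →+ ℤ where
  toFun f := f.coeff m
  map_zero' := rfl
  map_add' _ _ := rfl

@[simp] lemma coeffHom_apply (f : Completion b w) (m : Monomial b) :
    coeffHom b w m f = f.coeff m := rfl

@[simp] lemma coeff_zsmul (n : ℤ) (f : Completion b w) (m : Monomial b) :
    (n • f).coeff m = n * f.coeff m := by
  rw [← coeffHom_apply, map_zsmul, smul_eq_mul, coeffHom_apply]

variable (b w) in
/-- The Hahn series underlying a series. -/
def toHahn : Completion b w →+* HahnSeries (OrdMonomial b w) ℤ := (completionSubring b w).subtype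

lemma toHahn_injective : Function.Injective (toHahn b w) := Subtype.val_injective

variable (w) in
/-- A monomial as an element of the ordered group of monomials. -/
def ord (m : Monomial b) : OrdMonomial b w := m

lemma coeff_toHahn (f : Completion b w) (m : Monomial b) :
    (toHahn b w f).coeff (ord w m) = f.coeff m := rfl

lemma exists_of_coeff_mul_ne_zero {f g : Completion b w} {m : Monomial b}
    (h : (f * g).coeff m ≠ 0) :
    ∃ m₁ m₂, m₁ + m₂ = m ∧ f.coeff m₁ ≠ 0 ∧ g.coeff m₂ ≠ 0 := by
  obtain ⟨m₁, h₁, m₂, h₂, hm⟩ := Set.mem_add.1 (HahnSeries.support_mul_subset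
    (x := toHahn b w f) (y := toHahn b w g) (a := ord w m) h)
  exact ⟨m₁, m₂, hm, h₁, h₂⟩

lemma toHahn_monomial (m : Monomial b) :
    toHahn b w (monomial w m) = HahnSeries.single (ord w m) 1 := by
  refine HahnSeries.ext (funext fun m' => ?_)
  obtain ⟨m', rfl⟩ : ∃ x, ord w x = m' := ⟨m', rfl⟩
  rw [coeff_toHahn, coeff_monomial, HahnSeries.coeff_single]
  congr

lemma coeff_monomial_mul (x : Monomial b) (f : Completion b w) (m : Monomial b) :
    (monomial w x * f).coeff m = f.coeff (m - x) := by
  rw [← coeff_toHahn, map_mul, toHahn_monomial, HahnSeries.coeff_single_mul, one_mul]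
  rfl

lemma monomial_zero : monomial (b := b) w 0 = 1 :=
  toHahn_injective (by rw [toHahn_monomial, map_one (toHahn b w)]; rfl)

lemma monomial_add (m m' : Monomial b) :
    monomial w (m + m') = monomial w m * monomial w m' := by
  ext x
  rw [coeff_monomial_mul, coeff_monomial, coeff_monomial]
  congr 1
  rw [eq_iff_iff, sub_eq_iff_eq_add, add_comm]

end Completion

end Coefficients

/-! ### The filtration by depth -/

section Filtration

variable {b : P.Base} [P.IsRootSystem] {w : P.weylGroup}

open Completion

variable (b w) in
/-- The series all of whose (twisted) weights are below `μ`, with a difference of height at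
least `n`. -/
def Filt (μ : V) (n : ℕ) : AddSubgroup (Completion b w) where
  carrier := {f | ∀ m, f.coeff m ≠ 0 → Deep b n (μ - twt b w m)}
  zero_mem' m h := absurd rfl h
  add_mem' {f g} hf hg m h := by
    by_cases hfm : f.coeff m = 0
    · exact hg m (by simpa [hfm] using h)
    · exact hf m hfm
  neg_mem' {f} hf m h := hf m (by simpa using h)

lemma filt_anti {μ : V} {n n' : ℕ} (h : n' ≤ n) : Filt b w μ n ≤ Filt b w μ n' :=
  fun _ hf m hm => (hf m hm).mono h

/-- Replacing the bound `μ` by a higher bound gains the height of the difference. This is the gain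
of one level that drives the induction in `ringHom_eq_of_leading`. -/
lemma filt_mono {μ μ' : V} {n n' : ℕ} (h : Deep b n' (μ' - μ)) :
    Filt b w μ n ≤ Filt b w μ' (n' + n) := fun f hf m hm => by
  have := h.add (hf m hm)
  rwa [sub_add_sub_cancel] at this

lemma mul_mem_filt {μ ν : V} {n n' : ℕ} {f g : Completion b w}
    (hf : f ∈ Filt b w μ n) (hg : g ∈ Filt b w ν n') : f * g ∈ Filt b w (μ + ν) (n + n') := by
  intro m hm
  obtain ⟨m₁, m₂, rfl, h₁, h₂⟩ := exists_of_coeff_mul_ne_zero hm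
  rw [map_add, add_sub_add_comm]
  exact (hf m₁ h₁).add (hg m₂ h₂)

lemma monomial_mem_filt (m : Monomial b) : monomial w m ∈ Filt b w (twt b w m) 0 := by
  intro m' h
  rw [coeff_monomial] at h
  have : m' = m := by by_contra h'; exact h (if_neg h')
  rw [this, sub_self]
  exact deep_zero_iff.2 (zero_mem _)

lemma one_mem_filt : (1 : Completion b w) ∈ Filt b w 0 0 := by
  rw [← monomial_zero]
  simpa using monomial_mem_filt (w := w) (0 : Monomial b)

lemma pow_mem_filt {n : ℕ} {f : Completion b w} (hf : f ∈ Filt b w 0 n) (k : ℕ) :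
    f ^ k ∈ Filt b w 0 (k * n) := by
  induction k with
  | zero => simpa using one_mem_filt
  | succ k ih =>
    rw [pow_succ, add_mul, one_mul]
    simpa using mul_mem_filt ih hf

/-- The filtration is separated: a vector of $Q^+$ has a well-defined finite height. -/
lemma eq_zero_of_forall_mem_filt {μ : V} {f : Completion b w} (h : ∀ n, f ∈ Filt b w μ n) :
    f = 0 := by
  ext m
  by_contra hm
  obtain ⟨n, hn⟩ := exists_not_deep (b := b) (μ - twt b w m)
  exact hn (h n m hm)

/-- `1 + x` is invertible if `x` only has terms of negative weight. -/
lemma exists_mul_eq_one {x : Completion b w} (hx : x ∈ Filt b w 0 1) :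
    ∃ y ∈ Filt b w 0 0, (1 + x) * y = 1 := by
  -- Partial sums of the geometric series for $(1+x)^{-1}$. As $(-x)^n$ has depth $n$, the
  -- coefficient at `m` no longer changes once `-twt b w m` fails to have the required height.
  let s : ℕ → Completion b w := fun N => ∑ n ∈ Finset.range N, (-x) ^ n
  have hs0 : ∀ N, s N ∈ Filt b w 0 0 := fun N => AddSubgroup.sum_mem _ fun n _ =>
    filt_anti (Nat.zero_le _) (pow_mem_filt (neg_mem hx) n)
  have hs : ∀ N k, s (N + k) - s N ∈ Filt b w 0 N := by
    intro N k
    simp only [s, Finset.sum_range_add, add_sub_cancel_left]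
    exact AddSubgroup.sum_mem _ fun n _ => filt_anti (by omega) (pow_mem_filt (neg_mem hx) (N + n))
  have hex := fun m : Monomial b => exists_not_deep (b := b) (0 - twt b w m)
  choose N hN using hex
  have hstab : ∀ m N', ¬ Deep b N' (0 - twt b w m) → (s N').coeff m = (s (N m)).coeff m := by
    have key : ∀ m M M', ¬ Deep b M (0 - twt b w m) → M ≤ M' →
        (s M').coeff m = (s M).coeff m := by
      intro m M M' hM hMM
      obtain ⟨k, rfl⟩ := Nat.exists_eq_add_of_le hMM
      by_contra h
      exact hM (hs M k m (by simpa [sub_eq_zero] using h))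
    intro m N' hN'
    rcases le_total N' (N m) with h | h
    · exact (key m _ _ hN' h).symm
    · exact key m _ _ (hN m) h
  have hadm : IsAdmissible b w (Function.support fun m => (s (N m)).coeff m) := by
    refine ⟨⟨{0}, fun m hm => ⟨0, Finset.mem_singleton_self _, (hs0 _ m hm).mem⟩⟩, fun ν => ?_⟩
    -- A single stage `M` serves all monomials of weight `ν`, so finiteness at this weight is
    -- inherited from `s M`.
    obtain ⟨M, hM⟩ := exists_not_deep (b := b) (0 - w • ν)
    refine ((s M).admissible.2 ν).subset ?_
    rintro m ⟨hm, rfl⟩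
    refine ⟨?_, rfl⟩
    rwa [Function.mem_support, hstab m M hM]
  refine ⟨ofCoeff w _ hadm, fun m hm => hs0 _ m hm, ?_⟩
  rw [← sub_eq_zero]
  refine eq_zero_of_forall_mem_filt (μ := 0) fun M => ?_
  have h1 : ofCoeff w _ hadm - s M ∈ Filt b w 0 M := by
    intro m hm
    by_contra hM
    rw [coeff_sub, coeff_ofCoeff, hstab m M hM, sub_self] at hm
    exact hm rfl
  have h2 : (1 + x) * s M = 1 - (-x) ^ M := by
    have := mul_neg_geom_sum (-x) M
    rwa [sub_neg_eq_add] at this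
  have h3 : (1 + x) * ofCoeff w _ hadm - 1
      = (1 + x) * (ofCoeff w _ hadm - s M) + -(-x) ^ M := by
    rw [mul_sub, h2]; abel
  rw [h3]
  refine add_mem ?_ (neg_mem (by simpa using pow_mem_filt (neg_mem hx) M))
  simpa using mul_mem_filt (add_mem one_mem_filt (filt_anti (Nat.zero_le _) hx)) h1

end Filtration

/-! ### Laurent polynomials and extension by continuity -/

section Extension

open Completion

variable {b : P.Base}

/-- Sets of weights with finitely many elements below any given weight. -/
def LocFin (b : P.Base) (C : Set V) : Prop := ∀ l : V, {ν ∈ C | l - ν ∈ posCone b}.Finite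

variable (b) in
/-- The weights above some element of `C`. -/
def up (C : Set V) : Set V := {ν | ∃ μ ∈ C, ν - μ ∈ posCone b}

/-- Below `l` there are finitely many elements of `C`, and between each of them and `l` a finite
interval. Upward closures matter because a map that does not raise weights computes a coefficient at
weight `ν` only from coefficients at weights above `ν`. -/
lemma LocFin.up {C : Set V} (hC : LocFin b C) : LocFin b (up b C) := by
  intro l
  refine ((hC l).biUnion fun μ _ => (finite_posCone_interval b (l - μ)).image (μ + ·)).subset ?_
  rintro ν ⟨⟨μ, hμ, h⟩, hl⟩
  refine Set.mem_biUnion (x := μ) ⟨hμ, ?_⟩ ⟨ν - μ, ⟨h, ?_⟩, by simp⟩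
  · simpa using add_mem hl h
  · simpa using hl

lemma LocFin.of_finite {C : Set V} (hC : C.Finite) : LocFin b C :=
  fun _ => hC.subset fun _ h => h.1

lemma LocFin.union {C C' : Set V} (hC : LocFin b C) (hC' : LocFin b C') :
    LocFin b (C ∪ C') := fun l => ((hC l).union (hC' l)).subset fun _ h =>
  h.1.imp (fun h' => ⟨h', h.2⟩) fun h' => ⟨h', h.2⟩

variable [P.IsRootSystem] {w w' : P.weylGroup}

lemma Completion.finite_of_locFin (f : Completion b w) {C : Set V} (hC : LocFin b C) :
    {m | f.coeff m ≠ 0 ∧ twt b w m ∈ C}.Finite := by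
  obtain ⟨⟨Λ, hΛ⟩, hfin⟩ := f.admissible
  have : (⋃ ν ∈ ⋃ l ∈ Λ, {ν ∈ C | l - ν ∈ posCone b},
      {m ∈ Function.support f.coeff | weight b m = w⁻¹ • ν}).Finite :=
    (Λ.finite_toSet.biUnion fun l _ => hC l).biUnion fun ν _ => hfin _
  refine this.subset ?_
  rintro m ⟨hm, hmC⟩
  obtain ⟨l, hl, h⟩ := hΛ m hm
  exact Set.mem_biUnion (x := twt b w m) (Set.mem_biUnion (x := l) hl ⟨hmC, h⟩)
    ⟨hm, by simp [twt_apply]⟩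

variable (b) in
/-- The ring `𝒴` of Laurent polynomials. -/
abbrev Laurent : Type _ := AddMonoidAlgebra ℤ (Monomial b)

/-- A monomial as a Laurent polynomial. -/
def lm (m : Monomial b) : Laurent b := AddMonoidAlgebra.single m 1

lemma lm_add (m m' : Monomial b) : lm (m + m') = lm m * lm m' := by
  simp [lm, AddMonoidAlgebra.single_mul_single]

lemma single_eq_zsmul (m : Monomial b) (n : ℤ) :
    (AddMonoidAlgebra.single m n : Laurent b) = n • lm m := by
  simp [lm]

/-- The ring homomorphism out of Laurent polynomials with given values on monomials. -/
def liftMonomial {R : Type*} [CommRing R] (F : Multiplicative (Monomial b) →* R) :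
    Laurent b →+* R :=
  (AddMonoidAlgebra.lift ℤ R (Monomial b) F : Laurent b →+* R)

lemma liftMonomial_lm {R : Type*} [CommRing R] (F : Multiplicative (Monomial b) →* R)
    (m : Monomial b) : liftMonomial F (lm m) = F (.ofAdd m) := by
  change AddMonoidAlgebra.lift ℤ R (Monomial b) F (AddMonoidAlgebra.single m 1) = _
  rw [AddMonoidAlgebra.lift_single, one_smul]

lemma addHom_ext_lm {R : Type*} [AddCommGroup R] {f g : Laurent b →+ R}
    (h : ∀ m, f (lm m) = g (lm m)) : f = g := by
  refine DFunLike.ext _ _ fun p => ?_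
  induction p using AddMonoidAlgebra.induction_linear with
  | zero => rw [map_zero, map_zero]
  | add p p' hp hp' => rw [map_add, map_add, hp, hp']
  | single m n => rw [single_eq_zsmul, map_zsmul, map_zsmul, h]

variable (w) in
/-- The inclusion of the ring of Laurent polynomials. -/
def ofLaurent : Laurent b →+* Completion b w :=
  liftMonomial
    { toFun := fun m => monomial w m.toAdd
      map_one' := monomial_zero
      map_mul' := fun m m' => monomial_add m.toAdd m'.toAdd }

@[simp] lemma ofLaurent_lm (m : Monomial b) : ofLaurent w (lm m) = monomial w m :=
  liftMonomial_lm _ m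

lemma coeff_ofLaurent (p : Laurent b) (m : Monomial b) :
    (ofLaurent w p).coeff m = p.coeff m := by
  have : (coeffHom b w m).comp (ofLaurent w).toAddMonoidHom =
      (Finsupp.applyAddHom m).comp AddMonoidAlgebra.coeffAddEquiv.toAddMonoidHom := by
    refine addHom_ext_lm fun m' => ?_
    change (ofLaurent w (lm m')).coeff m = (lm m').coeff m
    rw [ofLaurent_lm, coeff_monomial]
    change _ = Finsupp.single m' (1 : ℤ) m
    rw [Finsupp.single_apply]
    simp only [eq_comm]
  exact DFunLike.congr_fun this p

/-- A series can be truncated to a Laurent polynomial at a set of weights with finitely many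
elements below any given weight. -/
lemma Completion.exists_truncation (f : Completion b w) {C : Set V} (hC : LocFin b C) :
    ∃ p : Laurent b, ∀ m, (ofLaurent w p).coeff m = if twt b w m ∈ C then f.coeff m else 0 := by
  refine ⟨.ofCoeff (Finsupp.ofSupportFinite (fun m => if twt b w m ∈ C then f.coeff m else 0)
    ((f.finite_of_locFin hC).subset ?_)), fun m => by rw [coeff_ofLaurent]; rfl⟩
  intro m hm
  by_cases h : twt b w m ∈ C
  · exact ⟨fun h0 => hm (by simp [h0]), h⟩
  · exact absurd (if_neg h) hm

/-- Continuous homomorphisms that agree on Laurent polynomials are equal. -/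
lemma ringHom_ext_of_continuous {S T : Completion b w →+* Completion b w'}
    (hS : Continuous S) (hT : Continuous T)
    (h : ∀ m, S (monomial w m) = T (monomial w m)) : S = T := by
  have hL : ∀ p, S (ofLaurent w p) = T (ofLaurent w p) := by
    intro p
    have : (S.comp (ofLaurent w)).toAddMonoidHom = (T.comp (ofLaurent w)).toAddMonoidHom :=
      addHom_ext_lm fun m => by simpa using h m
    exact DFunLike.congr_fun this p
  ext f m
  have hopen : ∀ c : ℤ, IsOpen {g : Completion b w' | g.coeff m = c} := fun c g hg =>
    ⟨{twt b w' m}, fun l => (Set.finite_singleton _).subset fun _ h => h.1,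
      fun g' hg' => (hg' m rfl).trans hg⟩
  -- By continuity, every series that agrees with `f` at the weights in `C ∪ C'` has images with the
  -- same coefficient at `m` as `S f` and `T f`. Truncating `f` there produces such a series that is
  -- a Laurent polynomial.
  obtain ⟨C, hC, hCS⟩ := (hopen ((S f).coeff m)).preimage hS f rfl
  obtain ⟨C', hC', hCT⟩ := (hopen ((T f).coeff m)).preimage hT f rfl
  obtain ⟨p, hp⟩ := f.exists_truncation (LocFin.union hC hC')
  have h1 := hCS (ofLaurent w p) fun m hm => (hp m).trans (if_pos (Or.inl hm))
  have h2 := hCT (ofLaurent w p) fun m hm => (hp m).trans (if_pos (Or.inr hm))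
  rw [Set.mem_preimage, Set.mem_ofPred_eq] at h1 h2
  rw [← h1, ← h2, hL]

/-! ### Extension by continuity of homomorphisms that do not raise weights -/

variable (φ : Laurent b →+* Completion b w')
  (hφ : ∀ m, φ (lm m) ∈ Filt b w' (twt b w m) 0)

-- Only monomials with weight above that of `m'` can contribute to the coefficient at `m'`, and the
-- weights above a given one form a locally finite set.
include hφ in
lemma finite_support_extend (f : Completion b w) (m' : Monomial b) :
    (Function.support fun m => f.coeff m * (φ (lm m)).coeff m').Finite := by
  refine (f.finite_of_locFin (LocFin.of_finite (Set.finite_singleton (twt b w' m'))).up).subset ?_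
  intro m hm
  exact ⟨left_ne_zero_of_mul hm, _, rfl, (hφ m m' (right_ne_zero_of_mul hm)).mem⟩

lemma exists_of_finsum_ne_zero {f : Completion b w} {m' : Monomial b}
    (hφ : ∀ m, φ (lm m) ∈ Filt b w' (twt b w m) 0)
    (h : ∑ᶠ m, f.coeff m * (φ (lm m)).coeff m' ≠ 0) :
    ∃ m, f.coeff m ≠ 0 ∧ (φ (lm m)).coeff m' ≠ 0 ∧ twt b w m - twt b w' m' ∈ posCone b := by
  obtain ⟨m, hm⟩ : ∃ m, f.coeff m * (φ (lm m)).coeff m' ≠ 0 := by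
    by_contra! h0
    exact h (by simp only [h0, finsum_zero])
  exact ⟨m, left_ne_zero_of_mul hm, right_ne_zero_of_mul hm,
    (hφ m m' (right_ne_zero_of_mul hm)).mem⟩

/-- The extension by continuity of a homomorphism on Laurent polynomials, as an additive map. -/
def extendAdd : Completion b w →+ Completion b w' where
  toFun f := ofCoeff w' (fun m' => ∑ᶠ m, f.coeff m * (φ (lm m)).coeff m') <| by
    obtain ⟨Λ, hΛ⟩ := f.admissible.1
    refine ⟨⟨Λ, fun m' hm' => ?_⟩, fun ν => ?_⟩
    · obtain ⟨m, hm, -, h⟩ := exists_of_finsum_ne_zero φ hφ hm'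
      obtain ⟨l, hl, h'⟩ := hΛ m hm
      refine ⟨l, hl, ?_⟩
      simpa [twt_apply] using add_mem h' h
    · refine ((f.finite_of_locFin (LocFin.of_finite (Set.finite_singleton (w' • ν))).up).biUnion
        fun m _ => (φ (lm m)).admissible.2 ν).subset ?_
      rintro m' ⟨hm', rfl⟩
      obtain ⟨m, hm, hm2, h⟩ := exists_of_finsum_ne_zero φ hφ hm'
      exact Set.mem_biUnion (x := m) ⟨hm, _, rfl, h⟩ ⟨hm2, rfl⟩
  map_zero' := by ext; simp
  map_add' f g := by
    ext m'
    simp only [coeff_ofCoeff, coeff_add, add_mul]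
    exact finsum_add_distrib (finite_support_extend φ hφ f m') (finite_support_extend φ hφ g m')

lemma coeff_extendAdd (f : Completion b w) (m' : Monomial b) :
    (extendAdd φ hφ f).coeff m' = ∑ᶠ m, f.coeff m * (φ (lm m)).coeff m' := rfl

lemma exists_of_coeff_extendAdd_ne_zero {f : Completion b w} {m' : Monomial b}
    (h : (extendAdd φ hφ f).coeff m' ≠ 0) :
    ∃ m, f.coeff m ≠ 0 ∧ twt b w m - twt b w' m' ∈ posCone b := by
  obtain ⟨m, hm, -, h'⟩ := exists_of_finsum_ne_zero φ hφ h
  exact ⟨m, hm, h'⟩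

lemma extendAdd_ofLaurent (p : Laurent b) : extendAdd φ hφ (ofLaurent w p) = φ p := by
  have : (extendAdd φ hφ).comp (ofLaurent w).toAddMonoidHom = φ.toAddMonoidHom := by
    refine addHom_ext_lm fun m => ?_
    change extendAdd φ hφ (ofLaurent w (lm m)) = φ (lm m)
    ext m'
    rw [ofLaurent_lm, coeff_extendAdd, finsum_eq_single _ m]
    · simp [coeff_monomial]
    · intro x hx
      simp [coeff_monomial, hx]
  exact DFunLike.congr_fun this p

lemma extendAdd_mul (f g : Completion b w) :
    extendAdd φ hφ (f * g) = extendAdd φ hφ f * extendAdd φ hφ g := by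
  set T := extendAdd φ hφ
  obtain ⟨Λ, hΛ⟩ := f.admissible.1
  obtain ⟨Λ', hΛ'⟩ := g.admissible.1
  have hT : ∀ (Λ : Finset V) (h : Completion b w),
      (∀ m, h.coeff m ≠ 0 → ∃ l ∈ Λ, l - twt b w m ∈ posCone b) →
      ∀ m, (T h).coeff m ≠ 0 → ∃ l ∈ Λ, l - twt b w' m ∈ posCone b := by
    intro Λ h hh m hm
    obtain ⟨m', hm', h'⟩ := exists_of_coeff_extendAdd_ne_zero φ hφ hm
    obtain ⟨l, hl, h''⟩ := hh m' hm'
    exact ⟨l, hl, by simpa using add_mem h'' h'⟩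
  have hmul : ∀ (u : P.weylGroup) (Λ : Finset V) (x y : Completion b u) (μ : V),
      (∀ m, x.coeff m ≠ 0 → ∃ l ∈ Λ, l - twt b u m ∈ posCone b) →
      (∀ m, y.coeff m ≠ 0 → ∀ l ∈ Λ, twt b u m - (μ - l) ∉ posCone b) →
      ∀ m, twt b u m - μ ∈ posCone b → (x * y).coeff m = 0 := by
    intro u Λ x y μ hx hy m hm
    by_contra h
    obtain ⟨m₁, m₂, rfl, h₁, h₂⟩ := exists_of_coeff_mul_ne_zero h
    obtain ⟨l, hl, h'⟩ := hx m₁ h₁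
    refine hy m₂ h₂ l hl ?_
    convert add_mem hm h' using 1
    rw [map_add]; abel
  have hvan : ∀ (S : Finset V) (h : Completion b w) (p : Laurent b),
      (∀ m, (ofLaurent w p).coeff m = if twt b w m ∈ up b S then h.coeff m else 0) →
      (∀ m, (h - ofLaurent w p).coeff m ≠ 0 → ∀ l ∈ S, twt b w m - l ∉ posCone b) ∧
      ∀ m, (T h - φ p).coeff m ≠ 0 → ∀ l ∈ S, twt b w' m - l ∉ posCone b := by
    intro S h p hp
    have h1 : ∀ m, (h - ofLaurent w p).coeff m ≠ 0 → ∀ l ∈ S, twt b w m - l ∉ posCone b := by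
      intro m hm l hl hml
      rw [coeff_sub, hp, if_pos ⟨l, hl, hml⟩, sub_self] at hm
      exact hm rfl
    refine ⟨h1, fun m hm l hl hml => ?_⟩
    rw [← extendAdd_ofLaurent φ hφ p, ← map_sub] at hm
    obtain ⟨m', hm', h'⟩ := exists_of_coeff_extendAdd_ne_zero φ hφ hm
    exact h1 m' hm' l hl (by simpa using add_mem h' hml)
  ext m
  set μ := twt b w' m with hμ
  -- The weights of `g` lie below `Λ'`, so a term of `f` can contribute to the product at weights
  -- above `μ` only if its weight is above some `μ - l`, `l ∈ Λ'`. Truncating `f` there, and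
  -- symmetrically `g` with `Λ`, changes neither side of the claim at `m`, and on Laurent
  -- polynomials `φ` is multiplicative.
  obtain ⟨p, hp⟩ := f.exists_truncation
    (LocFin.of_finite ((Λ'.image fun l => μ - l).finite_toSet)).up
  obtain ⟨r, hr⟩ := g.exists_truncation
    (LocFin.of_finite ((Λ.image fun l => μ - l).finite_toSet)).up
  obtain ⟨hp1, hp2⟩ := hvan _ f p hp
  obtain ⟨hr1, hr2⟩ := hvan _ g r hr
  simp only [Finset.forall_mem_image] at hp1 hp2 hr1 hr2
  have hpΛ : ∀ m, (ofLaurent w p).coeff m ≠ 0 → ∃ l ∈ Λ, l - twt b w m ∈ posCone b := by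
    intro m hm
    refine hΛ m fun h0 => hm ?_
    rw [hp, h0, ite_self]
  have hφp : T (ofLaurent w p) = φ p := extendAdd_ofLaurent φ hφ p
  have e1 : T (f * g) - φ (p * r) =
      T (g * (f - ofLaurent w p) + ofLaurent w p * (g - ofLaurent w r)) := by
    rw [← extendAdd_ofLaurent φ hφ, ← map_sub]
    congr 1
    rw [map_mul]; ring
  have e2 : T f * T g - φ (p * r) = T g * (T f - φ p) + φ p * (T g - φ r) := by
    rw [map_mul]; ring
  have h1 : (T (f * g) - φ (p * r)).coeff m = 0 := by
    rw [e1]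
    by_contra h
    obtain ⟨m', hm', h'⟩ := exists_of_coeff_extendAdd_ne_zero φ hφ h
    refine hm' ?_
    rw [coeff_add, hmul w Λ' g _ μ hΛ' (fun m hm l hl => hp1 m hm hl) m' h',
      hmul w Λ _ _ μ hpΛ (fun m hm l hl => hr1 m hm hl) m' h', add_zero]
  have h2 : (T f * T g - φ (p * r)).coeff m = 0 := by
    have hz : twt b w' m - μ ∈ posCone b := by rw [hμ, sub_self]; exact zero_mem _
    rw [e2, coeff_add, hmul w' Λ' _ _ μ (hT Λ' g hΛ') (fun m hm l hl => hp2 m hm hl) m hz,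
      hmul w' Λ _ _ μ (hφp ▸ hT Λ _ hpΛ) (fun m hm l hl => hr2 m hm hl) m hz, add_zero]
  rw [coeff_sub, sub_eq_zero] at h1 h2
  rw [h1, h2]

/-- A homomorphism on Laurent polynomials that does not raise weights extends by continuity to
the completion. -/
def extend : Completion b w →+* Completion b w' :=
  { extendAdd φ hφ with
    map_one' := by
      have := extendAdd_ofLaurent φ hφ 1
      rwa [map_one (ofLaurent w), map_one φ] at this
    map_mul' := extendAdd_mul φ hφ }

lemma extend_ofLaurent (p : Laurent b) : extend φ hφ (ofLaurent w p) = φ p :=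
  extendAdd_ofLaurent φ hφ p

lemma extend_monomial (m : Monomial b) : extend φ hφ (monomial w m) = φ (lm m) := by
  rw [← extend_ofLaurent φ hφ, ofLaurent_lm]

lemma extend_mem_filt {μ : V} {n : ℕ} {f : Completion b w} (hf : f ∈ Filt b w μ n) :
    extend φ hφ f ∈ Filt b w' μ n := by
  intro m hm
  obtain ⟨m', hm', h⟩ := exists_of_coeff_extendAdd_ne_zero φ hφ hm
  have := (hf m' hm').add (deep_zero_iff.2 h)
  rwa [sub_add_sub_cancel, add_zero] at this

lemma continuous_extend : Continuous (extend φ hφ) := by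
  refine ⟨fun U hU f hf => ?_⟩
  obtain ⟨C, hC, h⟩ := hU _ hf
  refine ⟨up b C, LocFin.up hC, fun g hg => h _ fun m hm => ?_⟩
  rw [← sub_eq_zero, ← coeff_sub, ← map_sub]
  by_contra hne
  obtain ⟨m', hm', h'⟩ := exists_of_coeff_extendAdd_ne_zero φ hφ hne
  exact hm' (by rw [coeff_sub, hg m' ⟨_, hm, h'⟩, sub_self])

end Extension

/-! ### Simple reflections and weights -/

section Reflections

variable {b : P.Base}

lemma simpleReflection_smul (i : b.support) (x : V) :
    simpleReflection b i • x = x - P.toLinearMap x (P.coroot i) • P.root i := by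
  rw [simpleReflection, RootPairing.weylGroup.ofIdx_smul, RootPairing.Equiv.reflection_smul,
    RootPairing.reflection_apply]
  rfl

lemma simpleReflection_smul_root [P.IsCrystallographic] (i j : b.support) :
    simpleReflection b i • P.root j = P.root j - cartan b i j • P.root i := by
  rw [simpleReflection_smul, ← Int.cast_smul_eq_zsmul K]
  congr 2
  have := P.algebraMap_pairingIn ℤ j i
  simpa [cartan] using this.symm

lemma cartan_self [P.IsCrystallographic] [Finite ι] (i : b.support) : cartan b i i = 2 :=
  b.cartanMatrix_apply_same i

lemma simpleReflection_smul_self (i : b.support) :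
    simpleReflection b i • P.root i = -P.root i := by
  rw [simpleReflection, RootPairing.weylGroup.ofIdx_smul, RootPairing.Equiv.reflection_smul,
    RootPairing.reflection_apply_self]

lemma simpleReflection_mul_self (i : b.support) :
    simpleReflection b i * simpleReflection b i = 1 := by
  refine Subtype.ext ?_
  change RootPairing.Equiv.reflection P i * RootPairing.Equiv.reflection P i = 1
  rw [mul_eq_one_iff_eq_inv, RootPairing.Equiv.reflection_inv]

lemma mul_simpleReflection_cancel (w : P.weylGroup) (i : b.support) :
    w * simpleReflection b i * simpleReflection b i = w := by
  rw [mul_assoc, simpleReflection_mul_self, mul_one]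

lemma simpleReflection_smul_fundamentalWeight [P.IsRootSystem] (i j : b.support) :
    simpleReflection b i • fundamentalWeight b j =
      fundamentalWeight b j - if j = i then P.root i else 0 := by
  rw [simpleReflection_smul, pairing_fundamentalWeight]
  split_ifs <;> simp

lemma smul_root_ne_zero (w : P.weylGroup) (i : ι) : w • P.root i ≠ 0 := by
  rw [RootPairing.weylGroup_apply_root]
  exact P.ne_zero _

end Reflections

/-! ### Invertible series of a given weight -/

section UnitsOfWeight

open Completion

variable {b : P.Base} [P.IsRootSystem] {w : P.weylGroup}

/-- The series `u` and its inverse have terms of weight at most `μ` and `-μ`. -/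
def HasWt (u : (Completion b w)ˣ) (μ : V) : Prop :=
  (u : Completion b w) ∈ Filt b w μ 0 ∧ ((u⁻¹ : (Completion b w)ˣ) : Completion b w) ∈ Filt b w (-μ) 0

lemma HasWt.mul {u v : (Completion b w)ˣ} {μ ν : V} (hu : HasWt u μ) (hv : HasWt v ν) :
    HasWt (u * v) (μ + ν) := by
  refine ⟨mul_mem_filt hu.1 hv.1, ?_⟩
  rw [mul_inv, neg_add]
  exact mul_mem_filt hu.2 hv.2

lemma HasWt.inv {u : (Completion b w)ˣ} {μ : V} (hu : HasWt u μ) : HasWt u⁻¹ (-μ) :=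
  ⟨hu.2, by rw [inv_inv, neg_neg]; exact hu.1⟩

lemma hasWt_one : HasWt (1 : (Completion b w)ˣ) 0 :=
  ⟨one_mem_filt, by rw [inv_one, neg_zero]; exact one_mem_filt⟩

variable (w) in
/-- A monomial as a unit. -/
def monomialUnit (m : Monomial b) : (Completion b w)ˣ where
  val := monomial w m
  inv := monomial w (-m)
  val_inv := by rw [← monomial_add, add_neg_cancel, monomial_zero]
  inv_val := by rw [← monomial_add, neg_add_cancel, monomial_zero]

@[simp] lemma coe_monomialUnit (m : Monomial b) :
    (monomialUnit w m : Completion b w) = monomial w m := rfl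

lemma monomialUnit_add (m m' : Monomial b) :
    monomialUnit w (m + m') = monomialUnit w m * monomialUnit w m' :=
  Units.ext (monomial_add m m')

variable (b w) in
/-- The homomorphism sending a monomial to the corresponding unit. -/
def monomialUnitHom : Monomial b →+ Additive (Completion b w)ˣ where
  toFun m := .ofMul (monomialUnit w m)
  map_zero' := congrArg Additive.ofMul (Units.ext monomial_zero)
  map_add' m m' := congrArg Additive.ofMul (monomialUnit_add m m')

lemma hasWt_monomialUnit (m : Monomial b) : HasWt (monomialUnit w m) (twt b w m) :=
  ⟨monomial_mem_filt m, by
    change monomial w (-m) ∈ _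
    rw [← map_neg]; exact monomial_mem_filt _⟩

/-- A series with a unique term of highest weight, with coefficient `±1`, is invertible. -/
lemma exists_unit_of_leading {f : Completion b w} {m₀ : Monomial b} {ε : ℤ}
    (hε : ε * ε = 1) (h₀ : f.coeff m₀ = ε)
    (h : ∀ m, f.coeff m ≠ 0 → m = m₀ ∨ Deep b 1 (twt b w m₀ - twt b w m)) :
    ∃ u : (Completion b w)ˣ, (u : Completion b w) = f ∧ HasWt u (twt b w m₀) := by
  -- Since `ε` is its own inverse, this divides `f` by its leading term, leaving `1 + x` with `x` of
  -- depth one.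
  have hx : ε • (monomial w (-m₀) * f) - 1 ∈ Filt b w 0 1 := by
    intro m hm
    rw [coeff_sub, coeff_zsmul, coeff_monomial_mul, ← monomial_zero, coeff_monomial,
      sub_neg_eq_add] at hm
    by_cases h0 : m = 0
    · rw [if_pos h0, h0, zero_add, h₀, hε, sub_self] at hm
      exact absurd rfl hm
    · rw [if_neg h0, sub_zero] at hm
      rcases h _ (right_ne_zero_of_mul hm) with h' | h'
      · exact absurd (by simpa using h') h0
      · simpa [sub_add_eq_sub_sub] using h'
  obtain ⟨y, hy, hxy⟩ := exists_mul_eq_one hx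
  rw [add_sub_cancel] at hxy
  have hinv : f * (ε • (monomial w (-m₀) * y)) = 1 := by
    rw [← hxy]; simp only [zsmul_eq_mul]; ring
  refine ⟨⟨f, _, hinv, by rw [mul_comm, hinv]⟩, rfl, ?_, ?_⟩
  · intro m hm
    rcases h m hm with rfl | h'
    · rw [sub_self]; exact deep_zero_iff.2 (zero_mem _)
    · exact h'.mono (Nat.zero_le 1)
  · refine AddSubgroup.zsmul_mem _ ?_ ε
    have := mul_mem_filt (monomial_mem_filt (w := w) (-m₀)) hy
    simpa using this

end UnitsOfWeight

/-! ### The series `Σ` -/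

section SigmaSeries

open Completion

variable {b : P.Base} [P.IsRootSystem] [P.IsCrystallographic] [Finite ι] (d : b.support → ℕ)
  (q : ℂˣ) (w : P.weylGroup) (i : b.support)

@[simp] lemma twt_A (a : ℂˣ) : twt b w (A b d q i a) = w • P.root i := by
  rw [twt_apply, weight_A]

lemma zpow_arg (a c : ℂˣ) {k l n : ℤ} (h : k + l = n) : a * c ^ k * c ^ l = a * c ^ n := by
  rw [mul_assoc, ← zpow_add, h]

/-- The index shift behind `Sigma_eq`: peeling off the factor $A_{i,a}$ leaves the product that
belongs to $aq_i^{-2}$. `sum_A_neg_succ` is the counterpart for the other expansion. -/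
lemma sum_A_pos_succ (a : ℂˣ) (k : ℕ) :
    ∑ j ∈ Finset.Icc 1 (k + 1), A b d q i (a * (q ^ d i) ^ (-2 * (j : ℤ) + 2)) = A b d q i a +
      ∑ j ∈ Finset.Icc 1 k, A b d q i (a * (q ^ d i) ^ (-2 : ℤ) * (q ^ d i) ^ (-2 * (j : ℤ) + 2)) := by
  induction k with
  | zero => simp
  | succ k ih =>
    rw [Finset.sum_Icc_succ_top (by omega), ih, Finset.sum_Icc_succ_top (by omega), add_assoc]
    congr 3
    rw [zpow_arg _ _ rfl]
    congr 2
    push_cast; ring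

lemma sum_A_neg_succ (a : ℂˣ) (k : ℕ) :
    ∑ j ∈ Finset.Icc 1 (k + 1), A b d q i (a * (q ^ d i) ^ (-2 : ℤ) * (q ^ d i) ^ (2 * (j : ℤ))) =
      A b d q i a + ∑ j ∈ Finset.Icc 1 k, A b d q i (a * (q ^ d i) ^ (2 * (j : ℤ))) := by
  induction k with
  | zero =>
    rw [zero_add, Finset.Icc_self, Finset.sum_singleton, zpow_arg a (q ^ d i) (n := 0) (by norm_num)]
    simp
  | succ k ih =>
    rw [Finset.sum_Icc_succ_top (by omega), ih, Finset.sum_Icc_succ_top (by omega), add_assoc]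
    congr 3
    rw [zpow_arg _ _ rfl]
    congr 2
    push_cast; ring

lemma twt_sum_A (s : Finset ℕ) (f : ℕ → ℂˣ) :
    twt b w (∑ j ∈ s, A b d q i (f j)) = s.card • (w • P.root i) := by
  simp

/-- The weight detects it, being a nonzero multiple of $\alpha_i$. -/
lemma sum_A_ne_zero {s : Finset ℕ} (hs : s.card ≠ 0) (f : ℕ → ℂˣ) :
    ∑ j ∈ s, A b d q i (f j) ≠ 0 := by
  intro h
  have := twt_sum_A d q (1 : P.weylGroup) i s f
  rw [h, map_zero, ← Nat.cast_smul_eq_nsmul K] at this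
  exact smul_ne_zero (Nat.cast_ne_zero.2 hs) (smul_root_ne_zero (1 : P.weylGroup) (i : ι)) this.symm

lemma nsmul_smul_root_ne_zero {k : ℕ} (hk : k ≠ 0) : k • (w • P.root i) ≠ 0 := by
  rw [← Nat.cast_smul_eq_nsmul K]
  exact smul_ne_zero (Nat.cast_ne_zero.2 hk) (smul_root_ne_zero w i)

lemma coeff_Sigma_of_pos (h : w • P.root i ∈ posCone b) (a : ℂˣ) (m : Monomial b) :
    (Sigma d q w i a).coeff m = sigmaPosCoeff b d q i a m := by
  rw [Sigma, dif_pos h, coeff_ofCoeff]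

lemma coeff_Sigma_of_neg (h : w • P.root i ∉ posCone b) (a : ℂˣ) (m : Monomial b) :
    (Sigma d q w i a).coeff m = sigmaNegCoeff b d q i a m := by
  rw [Sigma, dif_neg h, coeff_ofCoeff]

/-- The functional equation `Σ_{i,a} = 1 + A_{i,a}⁻¹ Σ_{i,a q_i⁻²}`. -/
lemma Sigma_eq (a : ℂˣ) : Sigma d q w i a =
    1 + monomial w (-A b d q i a) * Sigma d q w i (a * (q ^ d i) ^ (-2 : ℤ)) := by
  ext m
  rw [coeff_add, coeff_monomial_mul, ← monomial_zero, coeff_monomial, sub_neg_eq_add]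
  by_cases h : w • P.root i ∈ posCone b
  · rw [coeff_Sigma_of_pos d q w i h, coeff_Sigma_of_pos d q w i h]
    by_cases hm : m = 0
    · subst hm
      have h1 : sigmaPosCoeff b d q i a 0 = 1 := if_pos ⟨0, by simp⟩
      have h2 : sigmaPosCoeff b d q i (a * (q ^ d i) ^ (-2 : ℤ)) (0 + A b d q i a) = 0 := by
        refine if_neg ?_
        rintro ⟨k, hk⟩
        refine sum_A_ne_zero d q i (s := Finset.Icc 1 (k + 1)) (by simp) _
          ((sum_A_pos_succ d q i a k).trans ?_)
        rw [zero_add] at hk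
        rw [hk, neg_add_cancel]
      rw [h1, h2, if_pos rfl, add_zero]
    · rw [if_neg hm, zero_add]
      refine if_congr ⟨?_, ?_⟩ rfl rfl
      · rintro ⟨k, hk⟩
        cases k with
        | zero => exact absurd (by simpa using hk) hm
        | succ k =>
          rw [sum_A_pos_succ] at hk
          exact ⟨k, by rw [hk]; abel⟩
      · rintro ⟨k, hk⟩
        exact ⟨k + 1, by rw [sum_A_pos_succ, neg_add, ← hk]; abel⟩
  · rw [coeff_Sigma_of_neg d q w i h, coeff_Sigma_of_neg d q w i h]
    have h2 : (∃ k : ℕ, 0 < k ∧ m + A b d q i a = ∑ j ∈ Finset.Icc 1 k,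
        A b d q i (a * (q ^ d i) ^ (-2 : ℤ) * (q ^ d i) ^ (2 * (j : ℤ)))) ↔
        ∃ k : ℕ, m = ∑ j ∈ Finset.Icc 1 k, A b d q i (a * (q ^ d i) ^ (2 * (j : ℤ))) := by
      constructor
      · rintro ⟨k, hk, hm⟩
        obtain ⟨k, rfl⟩ := Nat.exists_eq_succ_of_ne_zero hk.ne'
        rw [Nat.succ_eq_add_one, sum_A_neg_succ, add_comm] at hm
        exact ⟨k, add_left_cancel hm⟩
      · rintro ⟨k, hm⟩
        exact ⟨k + 1, k.succ_pos, by rw [sum_A_neg_succ, ← hm, add_comm]⟩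
    rw [sigmaNegCoeff, sigmaNegCoeff, if_congr h2 rfl rfl]
    -- The term $k=1$ of $\Sigma^-_{i,aq_i^{-2}}$ is $-A_{i,a}$; after multiplication by
    -- $A_{i,a}^{-1}$ it cancels the constant $1$, in accordance with $\Sigma^-$ having no constant
    -- term.
    by_cases hm : m = 0
    · subst hm
      rw [if_neg, if_pos rfl, if_pos ⟨0, by simp⟩]; · norm_num
      rintro ⟨k, hk, h0⟩
      exact sum_A_ne_zero d q i (s := Finset.Icc 1 k) (by simp; omega) _ h0.symm
    · rw [if_neg hm, zero_add]
      refine if_congr ⟨fun ⟨k, _, hk⟩ => ⟨k, hk⟩, fun ⟨k, hk⟩ => ⟨k, ?_, hk⟩⟩ rfl rfl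
      rcases Nat.eq_zero_or_pos k with rfl | h0
      · exact absurd (by simpa using hk) hm
      · exact h0

/-- The weight of the leading term of `Σ^w_{i,a}`. -/
def sigmaWt : V := if w • P.root i ∈ posCone b then 0 else w • P.root i

/-- The leading term is the constant $1$ if $w\alpha_i>0$, and the term $k=1$, that is
$-A_{i,aq_i^2}$, otherwise. Successive terms descend by the positive one of $\pm w\alpha_i$. The
leading weight does not depend on `a`, so it cancels in quotients of two such series. -/
lemma exists_unit_Sigma (a : ℂˣ) : ∃ u : (Completion b w)ˣ,
    (u : Completion b w) = Sigma d q w i a ∧ HasWt u (sigmaWt w i) := by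
  by_cases h : w • P.root i ∈ posCone b
  · have h0 : sigmaWt w i = twt b w 0 := by rw [sigmaWt, if_pos h, map_zero]
    rw [h0]
    refine exists_unit_of_leading (ε := 1) (by norm_num) ?_ fun m hm => ?_
    · rw [coeff_Sigma_of_pos d q w i h]
      exact if_pos ⟨0, by simp⟩
    · rw [coeff_Sigma_of_pos d q w i h] at hm
      obtain ⟨k, rfl⟩ : ∃ k : ℕ, m = _ := by by_contra h'; exact hm (if_neg h')
      rcases Nat.eq_zero_or_pos k with rfl | hk
      · left; simp
      · right
        rw [map_neg, map_zero, twt_sum_A, zero_sub, neg_neg]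
        refine deep_one_of_mem (nsmul_mem h _) (nsmul_smul_root_ne_zero w i ?_)
        simp; omega
  · have h0 : sigmaWt w i = twt b w (A b d q i (a * (q ^ d i) ^ (2 : ℤ))) := by
      rw [sigmaWt, if_neg h, twt_A]
    rw [h0]
    refine exists_unit_of_leading (ε := -1) (by norm_num) ?_ fun m hm => ?_
    · rw [coeff_Sigma_of_neg d q w i h]
      exact if_pos ⟨1, one_pos, by simp⟩
    · rw [coeff_Sigma_of_neg d q w i h] at hm
      obtain ⟨k, hk, rfl⟩ : ∃ k : ℕ, 0 < k ∧ m = _ := by by_contra h'; exact hm (if_neg h')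
      obtain ⟨k, rfl⟩ := Nat.exists_eq_succ_of_ne_zero hk.ne'
      rcases Nat.eq_zero_or_pos k with rfl | hk
      · left; simp
      · right
        rw [twt_sum_A, twt_A]
        have e : w • P.root i - (Finset.Icc 1 (k + 1)).card • w • P.root i =
            k • -(w • P.root i) := by
          simp [add_smul]
        rw [e]
        refine deep_one_of_mem (nsmul_mem (neg_smul_root_mem b w i h) _) ?_
        rw [smul_neg, neg_ne_zero]
        exact nsmul_smul_root_ne_zero w i hk.ne'

/-- `Σ^w_{i,a}` as a unit. -/
def sigmaUnit (a : ℂˣ) : (Completion b w)ˣ := (exists_unit_Sigma d q w i a).choose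

@[simp] lemma coe_sigmaUnit (a : ℂˣ) : (sigmaUnit d q w i a : Completion b w) = Sigma d q w i a :=
  (exists_unit_Sigma d q w i a).choose_spec.1

lemma hasWt_sigmaUnit (a : ℂˣ) : HasWt (sigmaUnit d q w i a) (sigmaWt w i) :=
  (exists_unit_Sigma d q w i a).choose_spec.2

lemma isUnit_Sigma (a : ℂˣ) : IsUnit (Sigma d q w i a) := ⟨_, coe_sigmaUnit d q w i a⟩

end SigmaSeries

/-! ### Monomials without a given variable -/

section Free

variable {b : P.Base}

/-- The monomials in the variables `Y_{j,a}`, `j ≠ i`. -/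
def Free (i : b.support) : AddSubgroup (Monomial b) where
  carrier := {m | ∀ c, m (i, c) = 0}
  zero_mem' _ := rfl
  add_mem' hm hm' c := by simp [hm c, hm' c]
  neg_mem' hm c := by simp [hm c]

lemma Y_mem_free {i j : b.support} (h : j ≠ i) (a : ℂˣ) : Y j a ∈ Free i := fun c => by
  rw [Y, Finsupp.single_apply, if_neg]
  simp [h]

lemma eq_sum_Y (m : Monomial b) : m = ∑ p ∈ m.support, m p • Y p.1 p.2 := by
  conv_lhs => rw [← Finsupp.sum_single m]
  refine Finset.sum_congr rfl fun p _ => ?_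
  simp [Y]

lemma hom_eq_of_mem_free {G : Type*} [AddCommGroup G] {f g : Monomial b →+ G} {i : b.support}
    (h : ∀ j, j ≠ i → ∀ a, f (Y j a) = g (Y j a)) {m : Monomial b} (hm : m ∈ Free i) :
    f m = g m := by
  rw [eq_sum_Y m, map_sum, map_sum]
  refine Finset.sum_congr rfl fun p hp => ?_
  rw [map_zsmul, map_zsmul, h p.1 ?_ p.2]
  rintro rfl
  exact Finsupp.mem_support_iff.1 hp (hm p.2)

lemma mem_of_forall_Y_mem {S : AddSubgroup (Monomial b)} (h : ∀ j a, Y j a ∈ S)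
    (m : Monomial b) : m ∈ S := by
  rw [eq_sum_Y m]
  exact AddSubgroup.sum_mem _ fun p _ => AddSubgroup.zsmul_mem _ (h _ _) _

variable [P.IsCrystallographic] (d : b.support → ℕ) (q : ℂˣ)

/-- The part of `A_{i,a}⁻¹` in the variables `Y_{j,c}`, `j ≠ i`. -/
def Arest (i : b.support) (a : ℂˣ) : Monomial b :=
  Y i (a * (q ^ d i)⁻¹) + Y i (a * q ^ d i) - A b d q i a

lemma Arest_eq (i : b.support) (a : ℂˣ) : Arest d q i a =
    ∑ j with cartan b j i = -1, Y j a
    + ∑ j with cartan b j i = -2, (Y j (a * q⁻¹) + Y j (a * q))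
    + ∑ j with cartan b j i = -3, (Y j (a * q⁻¹ ^ 2) + Y j a + Y j (a * q ^ 2)) := by
  rw [Arest, A]; abel

lemma Arest_mem_free [Finite ι] (i : b.support) (a : ℂˣ) : Arest d q i a ∈ Free i := by
  have hne : ∀ j : b.support, ∀ c : ℤ, c < 0 → cartan b j i = c → j ≠ i := by
    rintro j c hc h rfl
    rw [cartan_self] at h
    omega
  rw [Arest_eq]
  refine add_mem (add_mem ?_ ?_) ?_ <;> refine AddSubgroup.sum_mem _ fun j hj => ?_ <;>
    have hj := (Finset.mem_filter.1 hj).2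
  · exact Y_mem_free (hne j _ (by norm_num) hj) _
  · exact add_mem (Y_mem_free (hne j _ (by norm_num) hj) _)
      (Y_mem_free (hne j _ (by norm_num) hj) _)
  · exact add_mem (add_mem (Y_mem_free (hne j _ (by norm_num) hj) _)
      (Y_mem_free (hne j _ (by norm_num) hj) _)) (Y_mem_free (hne j _ (by norm_num) hj) _)

end Free

/-! ### The operators `Θ_i^w` -/

section ThetaComponent

open Completion

variable {b : P.Base} [P.IsRootSystem] [P.IsCrystallographic] [Finite ι] (d : b.support → ℕ)
  (q : ℂˣ) (i : b.support) (w w' : P.weylGroup)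

/-- The value of `Θ_i` on `Y_{j,a}`, as a unit. -/
def thetaY (p : b.support × ℂˣ) : (Completion b w')ˣ :=
  if p.1 = i then monomialUnit w' (Y i p.2 - A b d q i (p.2 * (q ^ d i)⁻¹)) *
    sigmaUnit d q w' i (p.2 * (q ^ d i)⁻¹ ^ 3) * (sigmaUnit d q w' i (p.2 * (q ^ d i)⁻¹))⁻¹
  else monomialUnit w' (Y p.1 p.2)

/-- The homomorphism `Θ_i` on monomials. -/
def thetaHom : Monomial b →+ Additive (Completion b w')ˣ :=
  Finsupp.liftAddHom fun p => zmultiplesHom _ (Additive.ofMul (thetaY d q i w' p))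

lemma thetaHom_Y (j : b.support) (a : ℂˣ) :
    thetaHom d q i w' (Y j a) = .ofMul (thetaY d q i w' (j, a)) := by
  simp [thetaHom, Y]

/-- It suffices to check the generators. For $Y_{i,a}$ the monomial factor has weight
$\omega_i-\alpha_i=s_i\omega_i$ and the leading weights of the two series $\Sigma$ cancel; for $j\ne
i$, $s_i$ fixes $\omega_j$. -/
lemma hasWt_thetaHom (m : Monomial b) :
    HasWt (thetaHom d q i w' m).toMul (w' • simpleReflection b i • weight b m) := by
  let S : AddSubgroup (Monomial b) :=
    { carrier := {m | HasWt (thetaHom d q i w' m).toMul (w' • simpleReflection b i • weight b m)}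
      zero_mem' := by
        rw [Set.mem_ofPred_eq]
        simpa using hasWt_one
      add_mem' := fun {m m'} hm hm' => by
        rw [Set.mem_ofPred_eq] at hm hm' ⊢
        simpa using hm.mul hm'
      neg_mem' := fun {m} hm => by
        rw [Set.mem_ofPred_eq] at hm ⊢
        simpa using hm.inv }
  refine mem_of_forall_Y_mem (S := S) (fun j a => ?_) m
  change HasWt (thetaHom d q i w' (Y j a)).toMul (w' • simpleReflection b i • weight b (Y j a))
  rw [thetaHom_Y, toMul_ofMul, weight_Y, simpleReflection_smul_fundamentalWeight, thetaY]
  split_ifs with h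
  · have h1 := ((hasWt_monomialUnit (w := w') (Y i a - A b d q i (a * (q ^ d i)⁻¹))).mul
      (hasWt_sigmaUnit d q w' i (a * (q ^ d i)⁻¹ ^ 3))).mul
      (hasWt_sigmaUnit d q w' i (a * (q ^ d i)⁻¹)).inv
    rw [add_neg_cancel_right, map_sub, twt_A, twt_apply, weight_Y] at h1
    have h' : j = i := h
    rwa [h', smul_sub]
  · have h1 := hasWt_monomialUnit (w := w') (Y j a)
    rw [twt_apply, weight_Y] at h1
    rwa [sub_zero]

/-- The homomorphism `Θ_i` on Laurent polynomials. -/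
def thetaLaurent : Laurent b →+* Completion b w' :=
  liftMonomial ((Units.coeHom _).comp (AddMonoidHom.toMultiplicativeLeft (thetaHom d q i w')))

lemma thetaLaurent_lm (m : Monomial b) :
    thetaLaurent d q i w' (lm m) = ((thetaHom d q i w' m).toMul : Completion b w') :=
  liftMonomial_lm _ _

variable {w w'}

/-- With $w'=ws_i$ the leading weight $w's_i\omega(m)$ is $w\,\omega(m)$. This is why $\Theta_i$
extends to a map from the $w$-completion to the $ws_i$-completion. The target is a variable with an
equation, so that composites need no transport along $ws_is_i=w$. -/
lemma thetaLaurent_mem_filt (h : w' = w * simpleReflection b i) (m : Monomial b) :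
    thetaLaurent d q i w' (lm m) ∈ Filt b w' (twt b w m) 0 := by
  have := (hasWt_thetaHom d q i w' m).1
  rwa [h, ← mul_smul, mul_simpleReflection_cancel, ← twt_apply, ← h, ← thetaLaurent_lm] at this

/-- The operator `Θ_i^w : 𝒴̃^w → 𝒴̃^{w'}`, where `w' = w s_i`. -/
def theta (h : w' = w * simpleReflection b i) : Completion b w →+* Completion b w' :=
  extend (thetaLaurent d q i w') (thetaLaurent_mem_filt d q i h)

variable (h : w' = w * simpleReflection b i)

lemma continuous_theta : Continuous (theta d q i h) := continuous_extend _ _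

lemma theta_mem_filt {μ : V} {n : ℕ} {f : Completion b w} (hf : f ∈ Filt b w μ n) :
    theta d q i h f ∈ Filt b w' μ n := extend_mem_filt _ _ hf

lemma theta_monomial (m : Monomial b) :
    theta d q i h (monomial w m) = ((thetaHom d q i w' m).toMul : Completion b w') := by
  rw [theta, extend_monomial, thetaLaurent_lm]

lemma thetaHom_of_mem_free {m : Monomial b} (hm : m ∈ Free i) :
    thetaHom d q i w' m = .ofMul (monomialUnit w' m) := by
  refine hom_eq_of_mem_free (g := monomialUnitHom b w') (fun j hj a => ?_) hm
  rw [thetaHom_Y, thetaY, if_neg hj]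
  rfl

lemma theta_monomial_of_mem_free {m : Monomial b} (hm : m ∈ Free i) :
    theta d q i h (monomial w m) = monomial w' m := by
  rw [theta_monomial, thetaHom_of_mem_free d q i hm]
  rfl

lemma isThetaComponent_theta (w : P.weylGroup) : IsThetaComponent d q w i (theta d q i rfl) where
  continuous := continuous_theta d q i rfl
  map_of_ne j hj a := theta_monomial_of_mem_free d q i rfl (Y_mem_free hj a)
  map_self a := by
    rw [theta_monomial, thetaHom_Y, thetaY, if_pos rfl, toMul_ofMul, ← coe_sigmaUnit,
      ← coe_sigmaUnit, Ring.inverse_unit]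
    rfl

lemma ringHom_monomial_eq {S T : Completion b w →+* Completion b w'}
    (hST : ∀ j a, S (monomial w (Y j a)) = T (monomial w (Y j a))) (m : Monomial b) :
    S (monomial w m) = T (monomial w m) := by
  let toUnits : (Completion b w →+* Completion b w') → Monomial b →+ Additive (Completion b w')ˣ :=
    fun S => (MonoidHom.toAdditive (Units.map (S : Completion b w →* Completion b w'))).comp
      (monomialUnitHom b w)
  have key : ∀ S m, ((toUnits S m).toMul : Completion b w') = S (monomial w m) := fun _ _ => rfl
  have : m ∈ (toUnits S - toUnits T).ker := by
    refine mem_of_forall_Y_mem (fun j a => ?_) m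
    rw [AddMonoidHom.mem_ker, AddMonoidHom.sub_apply, sub_eq_zero]
    refine Additive.toMul.injective (Units.ext ?_)
    rw [key, key, hST]
  rw [AddMonoidHom.mem_ker, AddMonoidHom.sub_apply, sub_eq_zero] at this
  rw [← key, ← key, this]

lemma isThetaComponent_unique {w : P.weylGroup}
    {S T : Completion b w →+* Completion b (w * simpleReflection b i)}
    (hS : IsThetaComponent d q w i S) (hT : IsThetaComponent d q w i T) : S = T := by
  refine ringHom_ext_of_continuous hS.continuous hT.continuous
    (ringHom_monomial_eq fun j a => ?_)
  rcases eq_or_ne j i with rfl | hj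
  · rw [hS.map_self, hT.map_self]
  · rw [hS.map_of_ne j hj, hT.map_of_ne j hj]

/-! ### Invariants of `Θ_i` -/

/-- The Laurent polynomials fixed by `Θ_i`. -/
def Inv : Subring (Laurent b) where
  carrier := {p | ∀ (w w' : P.weylGroup) (h : w' = w * simpleReflection b i),
    theta d q i h (ofLaurent w p) = ofLaurent w' p}
  mul_mem' hp hp' w w' h := by rw [map_mul, map_mul, map_mul, hp w w' h, hp' w w' h]
  one_mem' w w' h := by rw [map_one, map_one, map_one]
  add_mem' hp hp' w w' h := by rw [map_add, map_add, map_add, hp w w' h, hp' w w' h]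
  zero_mem' w w' h := by rw [map_zero, map_zero, map_zero]
  neg_mem' hp w w' h := by rw [map_neg, map_neg, map_neg, hp w w' h]

lemma lm_mem_Inv {m : Monomial b} (hm : m ∈ Free i) : lm m ∈ Inv d q i := fun w w' h => by
  rw [ofLaurent_lm, ofLaurent_lm, theta_monomial_of_mem_free d q i h hm]

/-- The second term of the basic invariant is $Y_{i,aq_i^2}^{-1}$ times a monomial fixed by
$\Theta_i$. This makes its image computable, and makes it usable as a generator when $w\alpha_i<0$.
-/
lemma Y_sub_A (a : ℂˣ) : Y i a - A b d q i (a * q ^ d i) =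
    Arest d q i (a * q ^ d i) - Y i (a * (q ^ d i) ^ 2) := by
  rw [Arest, mul_inv_cancel_right, mul_assoc, ← sq]
  abel

/-- `Y_{i,a} (1 + A_{i,a q_i}⁻¹)` is invariant. -/
lemma Y_add_mem_Inv (a : ℂˣ) :
    lm (Y i a) + lm (Y i a - A b d q i (a * q ^ d i)) ∈ Inv d q i := by
  intro w w' h
  set Q := q ^ d i with hQ
  have hYu : ∀ c, (thetaHom d q i w' (Y i c)).toMul = monomialUnit w' (Y i c - A b d q i (c * Q⁻¹)) *
      sigmaUnit d q w' i (c * Q⁻¹ ^ 3) * (sigmaUnit d q w' i (c * Q⁻¹))⁻¹ := by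
    intro c
    rw [thetaHom_Y, toMul_ofMul, thetaY, if_pos rfl]
  have hB := Y_sub_A d q i a
  rw [← hQ] at hB
  have h1 : a * Q ^ 2 * Q⁻¹ = a * Q := by group
  have h2 : a * Q ^ 2 * Q⁻¹ ^ 3 = a * Q⁻¹ := by group
  have h3 : a * Q * Q ^ (-2 : ℤ) = a * Q⁻¹ := by group
  have h4 : a * Q⁻¹ * Q ^ (-2 : ℤ) = a * Q⁻¹ ^ 3 := by group
  have e2 : (thetaHom d q i w' (Y i a - A b d q i (a * Q))).toMul =
      monomialUnit w' (Y i a) * sigmaUnit d q w' i (a * Q) *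
        (sigmaUnit d q w' i (a * Q⁻¹))⁻¹ := by
    rw [hB, map_sub, thetaHom_of_mem_free d q i (Arest_mem_free d q i _), toMul_sub, toMul_ofMul,
      hYu, h1, h2, div_eq_iff_eq_mul]
    have hm : monomialUnit w' (Arest d q i (a * Q)) =
        monomialUnit w' (Y i a) * monomialUnit w' (Y i (a * Q ^ 2) - A b d q i (a * Q)) := by
      rw [← monomialUnit_add]
      congr 1
      rw [eq_add_of_sub_eq hB.symm]; abel
    rw [hm]
    have comm : ∀ y u v m : (Completion b w')ˣ,
        y * u * v⁻¹ * (m * v * u⁻¹) = y * m * (u * u⁻¹) * (v⁻¹ * v) := fun y u v m => by ac_rfl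
    rw [comm, mul_inv_cancel, inv_mul_cancel, mul_one, mul_one]
  -- With $Q=q_i$, the two images sum to
  -- $Y_{i,a}\,(A_{i,aQ^{-1}}^{-1}\Sigma_{i,aQ^{-3}}+\Sigma_{i,aQ})/\Sigma_{i,aQ^{-1}}$. By the
  -- functional equations the numerator is
  -- $(\Sigma_{i,aQ^{-1}}-1)+(1+A_{i,aQ}^{-1}\Sigma_{i,aQ^{-1}})$, which is divisible by
  -- $\Sigma_{i,aQ^{-1}}$.
  have f1 := Sigma_eq d q w' i (a * Q)
  have f2 := Sigma_eq d q w' i (a * Q⁻¹)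
  rw [← hQ, h3] at f1
  rw [← hQ, h4] at f2
  rw [map_add, map_add, ofLaurent_lm, ofLaurent_lm, map_add, theta_monomial, theta_monomial, e2,
    hYu]
  simp only [ofLaurent_lm, Units.val_mul, coe_monomialUnit, coe_sigmaUnit]
  rw [← (sigmaUnit d q w' i (a * Q⁻¹)).mul_left_inj]
  have hv := (sigmaUnit d q w' i (a * Q⁻¹)).inv_mul
  rw [coe_sigmaUnit] at hv ⊢
  simp only [sub_eq_add_neg, monomial_add]
  linear_combination (monomial w' (Y i a) * monomial w' (-A b d q i (a * Q⁻¹)) *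
      Sigma d q w' i (a * Q⁻¹ ^ 3) + monomial w' (Y i a) * Sigma d q w' i (a * Q)) * hv +
    monomial w' (Y i a) * f1 - monomial w' (Y i a) * f2

end ThetaComponent

/-! ### Rigidity -/

section Rigidity

open Completion

variable {b : P.Base} [P.IsRootSystem] {v u : P.weylGroup}

/-- Two continuous homomorphisms that do not raise weights are equal if they agree on sufficiently
many Laurent polynomials with a single highest term. -/
theorem ringHom_eq_of_leading {S T : Completion b v →+* Completion b u}
    (hS : Continuous S) (hT : Continuous T)
    (hSf : ∀ m, S (monomial v m) ∈ Filt b u (twt b v m) 0)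
    (hTf : ∀ m, T (monomial v m) ∈ Filt b u (twt b v m) 0)
    {G : Set (Monomial b)}
    (hgen : ∀ H : AddSubgroup (Monomial b), G ⊆ H → ∀ m, m ∈ H)
    (hG : ∀ m ∈ G, ∃ l : List (Monomial b),
      (∀ x ∈ l, Deep b 1 (twt b v m - twt b v x)) ∧
      S (ofLaurent v (lm m + (l.map lm).sum)) = T (ofLaurent v (lm m + (l.map lm).sum))) :
    S = T := by
  refine ringHom_ext_of_continuous hS hT fun m => ?_
  rw [← sub_eq_zero]
  refine eq_zero_of_forall_mem_filt (μ := twt b v m) fun n => ?_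
  -- If `S` and `T` agree to depth `n` below every monomial, those for which they agree to depth `n
  -- + 1` form a subgroup. It contains `G`: the difference at the leading monomial is minus the sum
  -- of the differences at strictly lower ones, where depth `n` counts as `n + 1`.
  induction n generalizing m with
  | zero => exact sub_mem (hSf m) (hTf m)
  | succ n ih =>
    let H : AddSubgroup (Monomial b) :=
      { carrier := {m | S (monomial v m) - T (monomial v m) ∈ Filt b u (twt b v m) (n + 1)}
        zero_mem' := by
          rw [Set.mem_ofPred_eq, monomial_zero, map_one, map_one, sub_self]
          exact zero_mem _
        add_mem' := fun {m m'} hm hm' => by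
          rw [Set.mem_ofPred_eq] at hm hm' ⊢
          have e : S (monomial v (m + m')) - T (monomial v (m + m')) =
              (S (monomial v m) - T (monomial v m)) * S (monomial v m') +
              T (monomial v m) * (S (monomial v m') - T (monomial v m')) := by
            rw [monomial_add, map_mul, map_mul]; ring
          rw [e, map_add]
          refine add_mem ?_ ?_
          · simpa using mul_mem_filt hm (hSf m')
          · simpa using mul_mem_filt (hTf m) hm'
        neg_mem' := fun {m} hm => by
          rw [Set.mem_ofPred_eq] at hm ⊢
          have e1 : S (monomial v m) * S (monomial v (-m)) = 1 := by
            rw [← map_mul, ← monomial_add, add_neg_cancel, monomial_zero, map_one]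
          have e2 : T (monomial v m) * T (monomial v (-m)) = 1 := by
            rw [← map_mul, ← monomial_add, add_neg_cancel, monomial_zero, map_one]
          have e : S (monomial v (-m)) - T (monomial v (-m)) =
              -((S (monomial v m) - T (monomial v m)) * S (monomial v (-m)) *
                T (monomial v (-m))) := by
            linear_combination T (monomial v (-m)) * e1 - S (monomial v (-m)) * e2
          rw [e]
          refine neg_mem ?_
          have := mul_mem_filt (mul_mem_filt hm (hSf (-m))) (hTf (-m))
          simpa using this }
    refine hgen H (fun m hm => ?_) m
    obtain ⟨l, hl, heq⟩ := hG m hm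
    change S (monomial v m) - T (monomial v m) ∈ Filt b u (twt b v m) (n + 1)
    have hsum : S (ofLaurent v (l.map lm).sum) - T (ofLaurent v (l.map lm).sum) ∈
        Filt b u (twt b v m) (n + 1) := by
      clear heq
      induction l with
      | nil => simp
      | cons x l ihl =>
        rw [List.map_cons, List.sum_cons, map_add, map_add, map_add, add_sub_add_comm]
        refine add_mem ?_ (ihl fun y hy => hl y (List.mem_cons_of_mem _ hy))
        rw [ofLaurent_lm, add_comm n 1]
        exact filt_mono (hl x List.mem_cons_self) (ih x)
    rw [map_add, map_add, map_add, ofLaurent_lm] at heq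
    have e : S (monomial v m) - T (monomial v m) =
        -(S (ofLaurent v (l.map lm).sum) - T (ofLaurent v (l.map lm).sum)) := by
      linear_combination heq
    rw [e]
    exact neg_mem hsum

/-- Isomorphisms of completions that are homeomorphisms and preserve the filtrations. -/
structure IsFiltered (f : Completion b v ≃+* Completion b u) : Prop where
  continuous : Continuous f
  continuous_symm : Continuous f.symm
  mem_filt : ∀ μ n x, x ∈ Filt b v μ n → f x ∈ Filt b u μ n
  symm_mem_filt : ∀ μ n x, x ∈ Filt b u μ n → f.symm x ∈ Filt b v μ n

lemma IsFiltered.refl : IsFiltered (RingEquiv.refl (Completion b v)) :=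
  ⟨continuous_id, continuous_id, fun _ _ _ h => h, fun _ _ _ h => h⟩

lemma IsFiltered.trans {t : P.weylGroup} {f : Completion b v ≃+* Completion b u}
    {g : Completion b u ≃+* Completion b t} (hf : IsFiltered f) (hg : IsFiltered g) :
    IsFiltered (f.trans g) :=
  ⟨hg.1.comp hf.1, hf.2.comp hg.2, fun μ n x h => hg.3 μ n _ (hf.3 μ n x h),
    fun μ n x h => hf.4 μ n _ (hg.4 μ n x h)⟩

end Rigidity

/-! ### The operators `Θ_i` are involutive -/

section Involutive

open Completion

variable {b : P.Base}

lemma free_le {i : b.support} {H : AddSubgroup (Monomial b)}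
    (h : ∀ j, j ≠ i → ∀ a, Y j a ∈ H) : Free i ≤ H := by
  intro m hm
  rw [eq_sum_Y m]
  refine AddSubgroup.sum_mem _ fun p hp => AddSubgroup.zsmul_mem _ (h p.1 ?_ p.2) _
  rintro rfl
  exact Finsupp.mem_support_iff.1 hp (hm p.2)

variable [P.IsRootSystem] [P.IsCrystallographic] [Finite ι] (d : b.support → ℕ)
  (q : ℂˣ) (i : b.support) {w w' : P.weylGroup}

/-- Both sides fix the invariants of $\Theta_i$, so rigidity applies. The leading monomial of
$Y_{i,a}+Y_{i,a}A_{i,aq_i}^{-1}$ is the first term if $w\alpha_i>0$ and the second if $w\alpha_i<0$;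
either family generates together with the $Y_{j,a}$, $j\ne i$. -/
lemma theta_comp_theta (h : w' = w * simpleReflection b i) (h' : w = w' * simpleReflection b i) :
    (theta d q i h').comp (theta d q i h) = RingHom.id _ := by
  have hinv : ∀ p ∈ Inv d q i, (theta d q i h').comp (theta d q i h) (ofLaurent w p) =
      RingHom.id _ (ofLaurent w p) := fun p hp => by
    rw [RingHom.comp_apply, hp w w' h, hp w' w h', RingHom.id_apply]
  have hc := (continuous_theta d q i h').comp (continuous_theta d q i h)
  have hf : ∀ m, (theta d q i h').comp (theta d q i h) (monomial w m) ∈ Filt b w (twt b w m) 0 :=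
    fun m => theta_mem_filt d q i h' (theta_mem_filt d q i h (monomial_mem_filt m))
  have hYj : ∀ m : Monomial b, (∃ j a, j ≠ i ∧ m = Y j a) → ∃ l : List (Monomial b),
      (∀ x ∈ l, Deep b 1 (twt b w m - twt b w x)) ∧
      (theta d q i h').comp (theta d q i h) (ofLaurent w (lm m + (l.map lm).sum)) =
        RingHom.id _ (ofLaurent w (lm m + (l.map lm).sum)) := by
    rintro _ ⟨j, a, hj, rfl⟩
    refine ⟨[], by simp, hinv _ ?_⟩
    simpa using lm_mem_Inv d q i (Y_mem_free hj a)
  by_cases hw : w • P.root i ∈ posCone b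
  · refine ringHom_eq_of_leading (G := {m | (∃ j a, j ≠ i ∧ m = Y j a) ∨ ∃ a, m = Y i a})
      hc continuous_id hf (fun m => monomial_mem_filt m) (fun H hH m => ?_) ?_
    · refine mem_of_forall_Y_mem (fun j a => hH ?_) m
      by_cases hj : j = i
      · exact Or.inr ⟨a, by rw [hj]⟩
      · exact Or.inl ⟨j, a, hj, rfl⟩
    · rintro m (hm | ⟨a, rfl⟩)
      · exact hYj m hm
      · refine ⟨[Y i a - A b d q i (a * q ^ d i)], ?_, hinv _ ?_⟩
        · simpa using deep_one_of_mem hw (smul_root_ne_zero w _)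
        · simpa using Y_add_mem_Inv d q i a
  · refine ringHom_eq_of_leading (G := {m | (∃ j a, j ≠ i ∧ m = Y j a) ∨
      ∃ a, m = Y i a - A b d q i (a * q ^ d i)})
      hc continuous_id hf (fun m => monomial_mem_filt m) (fun H hH m => ?_) ?_
    · have hfree : Free i ≤ H := free_le fun j hj a => hH (Or.inl ⟨j, a, hj, rfl⟩)
      refine mem_of_forall_Y_mem (fun j a => ?_) m
      by_cases hj : j = i
      -- At the parameter $aq_i^{-2}$ this generator is $Y_{i,a}^{-1}$ times a monomial without
      -- $i$-variables.
      · have h1 : Y i (a * (q ^ d i)⁻¹ ^ 2) - A b d q i (a * (q ^ d i)⁻¹ ^ 2 * q ^ d i) ∈ H :=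
          hH (Or.inr ⟨_, rfl⟩)
        have h2 := hfree (Arest_mem_free d q i (a * (q ^ d i)⁻¹ ^ 2 * q ^ d i))
        rw [Y_sub_A] at h1
        have h3 := sub_mem h2 h1
        rw [sub_sub_cancel, mul_assoc, ← mul_pow, inv_mul_cancel, one_pow, mul_one] at h3
        rwa [hj]
      · exact hfree (Y_mem_free hj a)
    · rintro m (hm | ⟨a, rfl⟩)
      · exact hYj m hm
      · refine ⟨[Y i a], ?_, hinv _ ?_⟩
        · simpa using deep_one_of_mem (neg_smul_root_mem b w i hw)
            (neg_ne_zero.2 (smul_root_ne_zero w _))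
        · rw [add_comm]
          simpa using Y_add_mem_Inv d q i a

lemma eq_mul_simpleReflection (h : w' = w * simpleReflection b i) :
    w = w' * simpleReflection b i := by
  rw [h, mul_simpleReflection_cancel]

/-- The operator `Θ_i^w` as an isomorphism. -/
def thetaEquiv (h : w' = w * simpleReflection b i) : Completion b w ≃+* Completion b w' :=
  RingEquiv.ofRingHom (theta d q i h) (theta d q i (eq_mul_simpleReflection i h))
    (theta_comp_theta d q i _ _) (theta_comp_theta d q i _ _)

lemma thetaEquiv_apply (h : w' = w * simpleReflection b i) (f : Completion b w) :
    thetaEquiv d q i h f = theta d q i h f := rfl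

lemma isFiltered_thetaEquiv (h : w' = w * simpleReflection b i) :
    IsFiltered (thetaEquiv d q i h) :=
  ⟨continuous_theta d q i h, continuous_theta d q i (eq_mul_simpleReflection i h),
    fun _ _ _ => theta_mem_filt d q i h,
    fun _ _ _ => theta_mem_filt d q i (eq_mul_simpleReflection i h)⟩

end Involutive

/-! ### Strings -/

section Strings

variable {b : P.Base}

variable [P.IsRootSystem] [P.IsCrystallographic] [Finite ι] {d : b.support → ℕ}
  {q : ℂˣ} {i : b.support} {c : ℂˣ} {D : ℤ}

/-- The monomial `Y_{i, a c ^ k}`. -/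
def Yz (a c : ℂˣ) (i : b.support) (k : ℤ) : Monomial b := Y i (a * c ^ k)

/-- The monomial `A_{i, a c ^ k}`. -/
def Az (d : b.support → ℕ) (q a c : ℂˣ) (i : b.support) (k : ℤ) : Monomial b :=
  A b d q i (a * c ^ k)

variable (hc : q ^ d i = c ^ D) {a : ℂˣ} {M : Monomial b}

include hc

lemma Yz_add_mem_Inv (k l : ℤ) (hl : l = k + D) :
    lm (Yz a c i k) + lm (Yz a c i k - Az d q a c i l) ∈ Inv d q i := by
  have := Y_add_mem_Inv d q i (a * c ^ k)
  rwa [hc, zpow_arg _ _ hl.symm] at this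

lemma Yz_add_sub_Az_mem_free (k l l' : ℤ) (hl : l = k + D) (hl' : l' = l + D) :
    Yz a c i k + Yz a c i l' - Az d q a c i l ∈ Free i := by
  have := Arest_mem_free d q i (a * c ^ l)
  rwa [Arest, hc, ← zpow_neg, zpow_arg _ _ (show l + -D = k by omega),
    zpow_arg _ _ hl'.symm] at this

/-- The strings are the $\mathfrak{sl}_2$-type blocks from which the rank two invariants are
assembled. Shifts are separate variables tied by equations, so that concrete numerals can be
supplied and checked by `rfl`. -/
lemma string_one (k l : ℤ) (hl : l = k + D) (hM : M - Yz a c i k ∈ Free i) :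
    lm M + lm (M - Az d q a c i l) ∈ Inv d q i := by
  have := mul_mem (lm_mem_Inv d q i hM) (Yz_add_mem_Inv hc (a := a) k l hl)
  rw [mul_add, ← lm_add, ← lm_add] at this
  convert this using 3 <;> abel

lemma string_pair (k l k' l' : ℤ) (hl : l = k + D) (hl' : l' = k' + D)
    (hM : M - Yz a c i k - Yz a c i k' ∈ Free i) :
    lm M + lm (M - Az d q a c i l) + lm (M - Az d q a c i l') +
      lm (M - Az d q a c i l - Az d q a c i l') ∈ Inv d q i := by
  have := mul_mem (lm_mem_Inv d q i hM) (mul_mem (Yz_add_mem_Inv hc (a := a) k l hl)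
    (Yz_add_mem_Inv hc (a := a) k' l' hl'))
  simp only [mul_add, add_mul, ← lm_add] at this
  convert this using 1
  abel_nf

/-- When the two parameters differ by $q_i^2$, one of the four monomials of `string_pair` loses all
its $i$-variables. It is then invariant by itself and can be removed. -/
lemma string_two (k k' l l' : ℤ) (hl : l = k + D) (hk' : k' = l + D) (hl' : l' = k' + D)
    (hM : M - Yz a c i k - Yz a c i k' ∈ Free i) :
    lm M + lm (M - Az d q a c i l') + lm (M - Az d q a c i l' - Az d q a c i l) ∈ Inv d q i := by
  have h1 := string_pair hc k l k' l' hl hl' hM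
  have h2 : lm (M - Az d q a c i l) ∈ Inv d q i := by
    refine lm_mem_Inv d q i ?_
    convert add_mem hM (Yz_add_sub_Az_mem_free hc (a := a) k l k' hl hk') using 1
    abel
  convert sub_mem h1 h2 using 1
  rw [sub_right_comm M]
  abel

/-- The product of a `string_two` with a further basic invariant has six terms. Two of them form a
`string_one` headed by `M` divided by the middle `A`, because that division cancels `k'` against
`k''`; they are removed. -/
lemma string_three (k k' k'' l l' l'' : ℤ) (hl : l = k + D) (hk' : k' = l + D) (hl' : l' = k' + D)
    (hk'' : k'' = l' + D) (hl'' : l'' = k'' + D)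
    (hM : M - Yz a c i k - Yz a c i k' - Yz a c i k'' ∈ Free i) :
    lm M + lm (M - Az d q a c i l'') + lm (M - Az d q a c i l'' - Az d q a c i l') +
      lm (M - Az d q a c i l'' - Az d q a c i l' - Az d q a c i l) ∈ Inv d q i := by
  have h0 := mul_mem (string_two hc (M := M - Yz a c i k'') k k' l l' hl hk' hl'
    (by convert hM using 1; abel)) (Yz_add_mem_Inv hc (a := a) k'' l'' hl'')
  have h1 := string_one hc (M := M - Az d q a c i l') k l hl (by
    convert add_mem hM (Yz_add_sub_Az_mem_free hc (a := a) k' l' k'' hl' hk'') using 1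
    abel)
  convert sub_mem h0 h1 using 1
  simp only [mul_add, add_mul, ← lm_add]
  abel_nf

end Strings

/-! ### Components of monomials -/

section Components

variable {b : P.Base}

/-- The exponents of the variables `Y_{j,c}`, for fixed `j`. -/
def comp (j : b.support) : Monomial b →+ (ℂˣ → ℤ) where
  toFun m c := m (j, c)
  map_zero' := rfl
  map_add' _ _ := rfl

lemma mem_free_iff {j : b.support} {m : Monomial b} : m ∈ Free j ↔ comp j m = 0 :=
  ⟨fun h => funext h, fun h c => congrFun h c⟩

lemma comp_Y_of_ne {i j : b.support} (h : i ≠ j) (a : ℂˣ) : comp j (Y i a) = 0 :=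
  mem_free_iff.1 (Y_mem_free h a)

lemma comp_sum_filter {j : b.support} (p : b.support → Prop) [DecidablePred p]
    (f : b.support → Monomial b)
    (hf : ∀ k, k ≠ j → comp j (f k) = 0) :
    comp j (∑ k with p k, f k) = if p j then comp j (f j) else 0 := by
  rw [map_sum, Finset.sum_filter, Finset.sum_eq_single j]
  · intro k _ hk
    rw [hf k hk, ite_self]
  · intro h
    exact absurd (Finset.mem_univ j) h

variable [P.IsCrystallographic] [Finite ι] {d : b.support → ℕ} {q : ℂˣ} {i j : b.support}

lemma comp_Arest (x : ℂˣ) : comp j (Arest d q i x) =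
    (if cartan b j i = -1 then comp j (Y j x) else 0)
    + (if cartan b j i = -2 then comp j (Y j (x * q⁻¹) + Y j (x * q)) else 0)
    + (if cartan b j i = -3 then comp j (Y j (x * q⁻¹ ^ 2) + Y j x + Y j (x * q ^ 2)) else 0) := by
  rw [Arest_eq, map_add, map_add, comp_sum_filter, comp_sum_filter, comp_sum_filter]
  all_goals
    intro k hk
    simp [comp_Y_of_ne hk]

lemma comp_A (hij : i ≠ j) (x : ℂˣ) :
    comp j (A b d q i x) = -comp j (Arest d q i x) := by
  rw [Arest, map_sub, map_add, comp_Y_of_ne hij, comp_Y_of_ne hij]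
  abel

variable {c : ℂˣ} {D : ℤ} (a : ℂˣ) (k : ℤ)

lemma comp_Yz_of_ne (hij : i ≠ j) : comp j (Yz a c i k) = 0 := comp_Y_of_ne hij _

lemma comp_Az_self (hc : q ^ d i = c ^ D) : comp i (Az d q a c i k) =
    comp i (Yz a c i (k - D)) + comp i (Yz a c i (k + D)) := by
  have h := mem_free_iff.1 (Arest_mem_free d q i (a * c ^ k))
  rw [Arest, hc, ← zpow_neg, zpow_arg _ _ rfl, zpow_arg _ _ rfl, map_sub, sub_eq_zero] at h
  rw [← map_add, sub_eq_add_neg]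
  exact h.symm

lemma comp_Az_of_eq_zero (hij : i ≠ j) (h : cartan b j i = 0) :
    comp j (Az d q a c i k) = 0 := by
  rw [Az, comp_A hij, comp_Arest]
  simp [h]

lemma comp_Az_of_eq_neg_one (hij : i ≠ j) (h : cartan b j i = -1) :
    comp j (Az d q a c i k) = -comp j (Yz a c j k) := by
  rw [Az, comp_A hij, comp_Arest]
  simp [h, Yz]

lemma comp_Az_of_eq_neg_two (hij : i ≠ j) (h : cartan b j i = -2) :
    comp j (Az d q a q i k) = -(comp j (Yz a q j (k - 1)) + comp j (Yz a q j (k + 1))) := by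
  rw [Az, comp_A hij, comp_Arest]
  simp [h, Yz, zpow_add, zpow_sub, mul_assoc]

lemma comp_Az_of_eq_neg_three (hij : i ≠ j) (h : cartan b j i = -3) :
    comp j (Az d q a q i k) = -(comp j (Yz a q j (k - 2)) + comp j (Yz a q j k) +
      comp j (Yz a q j (k + 2))) := by
  rw [Az, comp_A hij, comp_Arest]
  simp [h, Yz, zpow_add, zpow_sub, mul_assoc]

end Components

/-! ### Invariants for pairs of simple roots -/

section RankTwo

set_option linter.unusedSimpArgs false
set_option linter.unnecessarySeqFocus false

variable {b : P.Base} [P.IsRootSystem] {i j : b.support}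

/-- The weight of `m` is strictly below that of `m₀`, by a combination of `α_i` and `α_j`. -/
def Below (i j : b.support) (m₀ m : Monomial b) : Prop :=
  ∃ k k' : ℕ, 0 < k + k' ∧ weight b m₀ - weight b m = k • P.root i + k' • P.root j

lemma Below.swap {m₀ m : Monomial b} (h : Below i j m₀ m) : Below j i m₀ m := by
  obtain ⟨k, k', hk, h⟩ := h
  exact ⟨k', k, by omega, by rw [h, add_comm]⟩

variable [P.IsCrystallographic] [Finite ι] {d : b.support → ℕ} {q : ℂˣ}

lemma Below.sub_left {m₀ m : Monomial b} (h : Below i j m₀ m) (a c : ℂˣ) (k : ℤ) :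
    Below i j m₀ (m - Az d q a c i k) := by
  obtain ⟨n, n', hn, h⟩ := h
  refine ⟨n + 1, n', by omega, ?_⟩
  rw [map_sub, ← sub_add, h, Az, weight_A, succ_nsmul]
  abel

/-- The monomial `Y_{i,a} ∏ A_{x, a c^k}⁻¹`, where the product is over the list of the `(x, k)`. -/
def descend (d : b.support → ℕ) (q a c : ℂˣ) (i : b.support) :
    List (b.support × ℤ) → Monomial b
  | [] => Yz a c i 0
  | (x, k) :: l => descend d q a c i l - Az d q a c x k

lemma below_descend (a c : ℂˣ) {l : List (b.support × ℤ)} (hl : l ≠ [])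
    (h : ∀ p ∈ l, p.1 = i ∨ p.1 = j) : Below i j (Y i a) (descend d q a c i l) := by
  induction l with
  | nil => exact absurd rfl hl
  | cons p l ih =>
    obtain ⟨x, k⟩ := p
    rw [List.forall_mem_cons] at h
    rcases eq_or_ne l [] with rfl | hl
    · rcases h.1 with rfl | rfl
      · exact ⟨1, 0, one_pos, by simp [descend, Yz, Az, weight_A]⟩
      · exact ⟨0, 1, one_pos, by simp [descend, Yz, Az, weight_A]⟩
    · rcases h.1 with rfl | rfl
      · exact (ih hl h.2).sub_left a c k
      · exact ((ih hl h.2).swap.sub_left a c k).swap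

/-- Existence of a Laurent polynomial with highest monomial `Y_{i,a}` that is invariant under
`Θ_i` and `Θ_j`. -/
def HasInvariant (d : b.support → ℕ) (q : ℂˣ) (i j : b.support) (a : ℂˣ) : Prop :=
  ∃ l : List (Monomial b), lm (Y i a) + (l.map lm).sum ∈ Inv d q i ∧
    lm (Y i a) + (l.map lm).sum ∈ Inv d q j ∧ ∀ m ∈ l, Below i j (Y i a) m

/-- Here `c` is the unit of spectral shift: $q_i$ for orthogonal or simply laced pairs, where $d_i$
is not known, and $q$ for multiple bonds. In each case below the same monomials are grouped twice,
into strings for `i` and into strings for `j`; the side goals check that the head of each string has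
the right variables. -/
lemma hasInvariant_of_descend (a c : ℂˣ) (ls : List (List (b.support × ℤ)))
    (hls : ∀ l ∈ ls, l ≠ [] ∧ ∀ p ∈ l, p.1 = i ∨ p.1 = j)
    (hi : lm (descend d q a c i []) + (ls.map fun l => lm (descend d q a c i l)).sum ∈ Inv d q i)
    (hj : lm (descend d q a c i []) + (ls.map fun l => lm (descend d q a c i l)).sum ∈ Inv d q j) :
    HasInvariant d q i j a := by
  have h0 : descend d q a c i [] = Y i a := by simp [descend, Yz]
  rw [h0] at hi hj
  refine ⟨ls.map (descend d q a c i), ?_, ?_, ?_⟩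
  · rwa [List.map_map]
  · rwa [List.map_map]
  · rintro _ hm
    obtain ⟨l, hl, rfl⟩ := List.mem_map.1 hm
    exact below_descend a c (hls l hl).1 (hls l hl).2

/-- The invariant for a pair of orthogonal simple roots. -/
lemma hasInvariant_of_orthogonal (hij : i ≠ j) (hCji : cartan b j i = 0)
    (a : ℂˣ) : HasInvariant d q i j a := by
  have hci : q ^ d i = (q ^ d i) ^ (1 : ℤ) := by simp
  let M := descend d q a (q ^ d i) i
  refine hasInvariant_of_descend a (q ^ d i) [[(i, 1)]]
    (by simp only [List.forall_mem_cons]; simp) ?_ ?_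
  · convert
    string_one hci (a := a) (M := M []) 0 1 rfl (mem_free_iff.2 ?_) using 1
    · simp only [M, descend, List.map_cons, List.map_nil, List.sum_cons, List.sum_nil]
      abel_nf
    all_goals
      simp only [M, descend, map_sub, comp_Az_self _ _ hci, comp_Yz_of_ne _ _ hij.symm,
        Int.reduceAdd, Int.reduceSub, Int.reduceNeg] <;> abel
  · convert
      add_mem
        (lm_mem_Inv d q j (m := M []) (mem_free_iff.2 ?_))
        (lm_mem_Inv d q j (m := M [(i, 1)]) (mem_free_iff.2 ?_)) using 1
    · simp only [M, descend, List.map_cons, List.map_nil, List.sum_cons, List.sum_nil]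
      abel_nf
    all_goals
      simp only [M, descend, map_sub, comp_Yz_of_ne _ _ hij, comp_Az_of_eq_zero _ _ hij hCji,
        Int.reduceAdd, Int.reduceSub, Int.reduceNeg] <;> abel

/-- The invariant for a pair of simple roots that span a system of type `A₂`. -/
lemma hasInvariant_of_simply_laced (hij : i ≠ j) (hCji : cartan b j i = -1)
    (hCij : cartan b i j = -1) (hd : d j = d i)
    (a : ℂˣ) : HasInvariant d q i j a := by
  have hci : q ^ d i = (q ^ d i) ^ (1 : ℤ) := by simp
  have hcj : q ^ d j = (q ^ d i) ^ (1 : ℤ) := by simp [hd]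
  let M := descend d q a (q ^ d i) i
  -- The three monomials of the fundamental $q$-character of type $A_2$. Each list is read from
  -- right to left, starting at $Y_{i,a}$.
  refine hasInvariant_of_descend a (q ^ d i) [[(i, 1)],
    [(j, 2), (i, 1)]]
    (by simp only [List.forall_mem_cons]; simp) ?_ ?_
  · convert
      add_mem
        (string_one hci (a := a) (M := M []) 0 1 rfl (mem_free_iff.2 ?_))
        (lm_mem_Inv d q i (m := M [(j, 2), (i, 1)]) (mem_free_iff.2 ?_)) using 1
    · simp only [M, descend, List.map_cons, List.map_nil, List.sum_cons, List.sum_nil]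
      abel_nf
    all_goals
      simp only [M, descend, map_sub, comp_Az_self _ _ hci, comp_Yz_of_ne _ _ hij.symm,
        comp_Az_of_eq_neg_one _ _ hij.symm hCij, Int.reduceAdd, Int.reduceSub, Int.reduceNeg] <;>
        abel
  · convert
      add_mem
        (lm_mem_Inv d q j (m := M []) (mem_free_iff.2 ?_))
        (string_one hcj (a := a) (M := M [(i, 1)]) 1 2 rfl (mem_free_iff.2 ?_)) using 1
    · simp only [M, descend, List.map_cons, List.map_nil, List.sum_cons, List.sum_nil]
      abel_nf
    all_goals
      simp only [M, descend, map_sub, comp_Az_self _ _ hcj, comp_Yz_of_ne _ _ hij,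
        comp_Az_of_eq_neg_one _ _ hij hCji, Int.reduceAdd, Int.reduceSub, Int.reduceNeg] <;> abel

/-- The invariant for the long root in a system of type `B₂`. -/
lemma hasInvariant_of_double_long (hij : i ≠ j) (hCji : cartan b j i = -2)
    (hCij : cartan b i j = -1) (hdi : d i = 2) (hdj : d j = 1)
    (a : ℂˣ) : HasInvariant d q i j a := by
  have hci : q ^ d i = q ^ (2 : ℤ) := by rw [hdi]; rfl
  have hcj : q ^ d j = q ^ (1 : ℤ) := by simp [hdj]
  let M := descend d q a q i
  -- With $Y_{i,a}$, the five monomials of the fundamental $q$-character at the long node of $B_2$.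
  refine hasInvariant_of_descend a q [[(i, 2)],
    [(j, 4), (i, 2)],
    [(j, 2), (j, 4), (i, 2)],
    [(i, 4), (j, 2), (j, 4), (i, 2)]]
    (by simp only [List.forall_mem_cons]; simp) ?_ ?_
  · convert
      add_mem (add_mem
        (string_one hci (a := a) (M := M []) 0 2 rfl (mem_free_iff.2 ?_))
        (lm_mem_Inv d q i (m := M [(j, 4), (i, 2)]) (mem_free_iff.2 ?_)))
        (string_one hci (a := a) (M := M [(j, 2), (j, 4), (i, 2)]) 2 4 rfl (mem_free_iff.2 ?_)) using 1
    · simp only [M, descend, List.map_cons, List.map_nil, List.sum_cons, List.sum_nil]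
      abel_nf
    all_goals
      simp only [M, descend, map_sub, comp_Az_self _ _ hci, comp_Yz_of_ne _ _ hij.symm,
        comp_Az_of_eq_neg_one _ _ hij.symm hCij, Int.reduceAdd, Int.reduceSub, Int.reduceNeg] <;>
        abel
  · convert
      add_mem (add_mem
        (lm_mem_Inv d q j (m := M []) (mem_free_iff.2 ?_))
        (string_two hcj (a := a) (M := M [(i, 2)]) 1 3 2 4 rfl rfl rfl (mem_free_iff.2 ?_)))
        (lm_mem_Inv d q j (m := M [(i, 4), (j, 2), (j, 4), (i, 2)]) (mem_free_iff.2 ?_)) using 1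
    · simp only [M, descend, List.map_cons, List.map_nil, List.sum_cons, List.sum_nil]
      abel_nf
    all_goals
      simp only [M, descend, map_sub, comp_Az_self _ _ hcj, comp_Yz_of_ne _ _ hij,
        comp_Az_of_eq_neg_two _ _ hij hCji, Int.reduceAdd, Int.reduceSub, Int.reduceNeg] <;> abel

/-- The invariant for the short root in a system of type `B₂`. -/
lemma hasInvariant_of_double_short (hij : i ≠ j) (hCji : cartan b j i = -1)
    (hCij : cartan b i j = -2) (hdi : d i = 1) (hdj : d j = 2)
    (a : ℂˣ) : HasInvariant d q i j a := by
  have hci : q ^ d i = q ^ (1 : ℤ) := by simp [hdi]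
  have hcj : q ^ d j = q ^ (2 : ℤ) := by rw [hdj]; rfl
  let M := descend d q a q i
  -- With $Y_{i,a}$, the four monomials of the fundamental $q$-character at the short node of $B_2$.
  refine hasInvariant_of_descend a q [[(i, 1)],
    [(j, 3), (i, 1)],
    [(i, 5), (j, 3), (i, 1)]]
    (by simp only [List.forall_mem_cons]; simp) ?_ ?_
  · convert
      add_mem
        (string_one hci (a := a) (M := M []) 0 1 rfl (mem_free_iff.2 ?_))
        (string_one hci (a := a) (M := M [(j, 3), (i, 1)]) 4 5 rfl (mem_free_iff.2 ?_)) using 1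
    · simp only [M, descend, List.map_cons, List.map_nil, List.sum_cons, List.sum_nil]
      abel_nf
    all_goals
      simp only [M, descend, map_sub, comp_Az_self _ _ hci, comp_Yz_of_ne _ _ hij.symm,
        comp_Az_of_eq_neg_two _ _ hij.symm hCij, Int.reduceAdd, Int.reduceSub, Int.reduceNeg] <;>
        abel
  · convert
      add_mem (add_mem
        (lm_mem_Inv d q j (m := M []) (mem_free_iff.2 ?_))
        (string_one hcj (a := a) (M := M [(i, 1)]) 1 3 rfl (mem_free_iff.2 ?_)))
        (lm_mem_Inv d q j (m := M [(i, 5), (j, 3), (i, 1)]) (mem_free_iff.2 ?_)) using 1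
    · simp only [M, descend, List.map_cons, List.map_nil, List.sum_cons, List.sum_nil]
      abel_nf
    all_goals
      simp only [M, descend, map_sub, comp_Az_self _ _ hcj, comp_Yz_of_ne _ _ hij,
        comp_Az_of_eq_neg_one _ _ hij hCji, Int.reduceAdd, Int.reduceSub, Int.reduceNeg] <;> abel

/-- The invariant for the short root in a system of type `G₂`. -/
lemma hasInvariant_of_triple_short (hij : i ≠ j) (hCji : cartan b j i = -1)
    (hCij : cartan b i j = -3) (hdi : d i = 1) (hdj : d j = 3)
    (a : ℂˣ) : HasInvariant d q i j a := by
  have hci : q ^ d i = q ^ (1 : ℤ) := by simp [hdi]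
  have hcj : q ^ d j = q ^ (3 : ℤ) := by rw [hdj]; rfl
  let M := descend d q a q i
  -- With $Y_{i,a}$, the seven monomials of the fundamental $q$-character at the short node of
  -- $G_2$.
  refine hasInvariant_of_descend a q [[(i, 1)],
    [(j, 4), (i, 1)],
    [(i, 7), (j, 4), (i, 1)],
    [(i, 5), (i, 7), (j, 4), (i, 1)],
    [(j, 8), (i, 5), (i, 7), (j, 4), (i, 1)],
    [(i, 11), (j, 8), (i, 5), (i, 7), (j, 4), (i, 1)]]
    (by simp only [List.forall_mem_cons]; simp) ?_ ?_
  · convert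
      add_mem (add_mem
        (string_one hci (a := a) (M := M []) 0 1 rfl (mem_free_iff.2 ?_))
        (string_two hci (a := a) (M := M [(j, 4), (i, 1)]) 4 6 5 7 rfl rfl rfl (mem_free_iff.2
          ?_)))
        (string_one hci (a := a) (M := M [(j, 8), (i, 5), (i, 7), (j, 4), (i, 1)]) 10 11 rfl
          (mem_free_iff.2 ?_)) using 1
    · simp only [M, descend, List.map_cons, List.map_nil, List.sum_cons, List.sum_nil]
      abel_nf
    all_goals
      simp only [M, descend, map_sub, comp_Az_self _ _ hci, comp_Yz_of_ne _ _ hij.symm,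
        comp_Az_of_eq_neg_three _ _ hij.symm hCij, Int.reduceAdd, Int.reduceSub, Int.reduceNeg] <;>
        abel
  · convert
      add_mem (add_mem (add_mem (add_mem
        (lm_mem_Inv d q j (m := M []) (mem_free_iff.2 ?_))
        (string_one hcj (a := a) (M := M [(i, 1)]) 1 4 rfl (mem_free_iff.2 ?_)))
        (lm_mem_Inv d q j (m := M [(i, 7), (j, 4), (i, 1)]) (mem_free_iff.2 ?_)))
        (string_one hcj (a := a) (M := M [(i, 5), (i, 7), (j, 4), (i, 1)]) 5 8 rfl (mem_free_iff.2
          ?_)))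
        (lm_mem_Inv d q j (m := M [(i, 11), (j, 8), (i, 5), (i, 7), (j, 4), (i, 1)])
          (mem_free_iff.2 ?_)) using 1
    · simp only [M, descend, List.map_cons, List.map_nil, List.sum_cons, List.sum_nil]
      abel_nf
    all_goals
      simp only [M, descend, map_sub, comp_Az_self _ _ hcj, comp_Yz_of_ne _ _ hij,
        comp_Az_of_eq_neg_one _ _ hij hCji, Int.reduceAdd, Int.reduceSub, Int.reduceNeg] <;> abel

/-- The invariant for the long root in a system of type `G₂`. -/
lemma hasInvariant_of_triple_long (hij : i ≠ j) (hCji : cartan b j i = -3)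
    (hCij : cartan b i j = -1) (hdi : d i = 3) (hdj : d j = 1)
    (a : ℂˣ) : HasInvariant d q i j a := by
  have hci : q ^ d i = q ^ (3 : ℤ) := by rw [hdi]; rfl
  have hcj : q ^ d j = q ^ (1 : ℤ) := by simp [hdj]
  let M := descend d q a q i
  -- With $Y_{i,a}$, the fifteen monomials of the fundamental $q$-character at the long node of
  -- $G_2$. The branching comes from pairs of variables in general position (shifts 2, 4 for `i` and
  -- 1, 9 for `j`), which contribute full four-term blocks.
  refine hasInvariant_of_descend a q [[(i, 3)],
    [(j, 6), (i, 3)],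
    [(j, 4), (j, 6), (i, 3)],
    [(j, 2), (j, 4), (j, 6), (i, 3)],
    [(i, 7), (j, 4), (j, 6), (i, 3)],
    [(j, 2), (i, 7), (j, 4), (j, 6), (i, 3)],
    [(j, 10), (i, 7), (j, 4), (j, 6), (i, 3)],
    [(j, 10), (j, 2), (i, 7), (j, 4), (j, 6), (i, 3)],
    [(i, 5), (j, 2), (j, 4), (j, 6), (i, 3)],
    [(i, 7), (i, 5), (j, 2), (j, 4), (j, 6), (i, 3)],
    [(j, 10), (i, 7), (i, 5), (j, 2), (j, 4), (j, 6), (i, 3)],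
    [(j, 8), (j, 10), (i, 7), (i, 5), (j, 2), (j, 4), (j, 6), (i, 3)],
    [(j, 6), (j, 8), (j, 10), (i, 7), (i, 5), (j, 2), (j, 4), (j, 6), (i, 3)],
    [(i, 9), (j, 6), (j, 8), (j, 10), (i, 7), (i, 5), (j, 2), (j, 4), (j, 6), (i, 3)]]
    (by simp only [List.forall_mem_cons]; simp) ?_ ?_
  · convert
      add_mem (add_mem (add_mem (add_mem (add_mem (add_mem (add_mem
        (string_one hci (a := a) (M := M []) 0 3 rfl (mem_free_iff.2 ?_))
        (lm_mem_Inv d q i (m := M [(j, 6), (i, 3)]) (mem_free_iff.2 ?_)))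
        (string_one hci (a := a) (M := M [(j, 4), (j, 6), (i, 3)]) 4 7 rfl (mem_free_iff.2 ?_)))
        (string_pair hci (a := a) (M := M [(j, 2), (j, 4), (j, 6), (i, 3)]) 2 5 4 7 rfl rfl
          (mem_free_iff.2 ?_)))
        (lm_mem_Inv d q i (m := M [(j, 10), (i, 7), (j, 4), (j, 6), (i, 3)]) (mem_free_iff.2 ?_)))
        (string_one hci (a := a) (M := M [(j, 10), (j, 2), (i, 7), (j, 4), (j, 6), (i, 3)]) 2 5 rfl
          (mem_free_iff.2 ?_)))
        (lm_mem_Inv d q i (m := M [(j, 8), (j, 10), (i, 7), (i, 5), (j, 2), (j, 4), (j, 6), (i,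
          3)]) (mem_free_iff.2 ?_)))
        (string_one hci (a := a) (M := M [(j, 6), (j, 8), (j, 10), (i, 7), (i, 5), (j, 2), (j, 4),
          (j, 6), (i, 3)]) 6 9 rfl (mem_free_iff.2 ?_)) using 1
    · simp only [M, descend, List.map_cons, List.map_nil, List.sum_cons, List.sum_nil]
      abel_nf
    all_goals
      simp only [M, descend, map_sub, comp_Az_self _ _ hci, comp_Yz_of_ne _ _ hij.symm,
        comp_Az_of_eq_neg_one _ _ hij.symm hCij, Int.reduceAdd, Int.reduceSub, Int.reduceNeg] <;>
        abel
  · convert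
      add_mem (add_mem (add_mem (add_mem (add_mem
        (lm_mem_Inv d q j (m := M []) (mem_free_iff.2 ?_))
        (string_three hcj (a := a) (M := M [(i, 3)]) 1 3 5 2 4 6 rfl rfl rfl rfl rfl
          (mem_free_iff.2 ?_)))
        (string_pair hcj (a := a) (M := M [(i, 7), (j, 4), (j, 6), (i, 3)]) 1 2 9 10 rfl rfl
          (mem_free_iff.2 ?_)))
        (lm_mem_Inv d q j (m := M [(i, 5), (j, 2), (j, 4), (j, 6), (i, 3)]) (mem_free_iff.2 ?_)))
        (string_three hcj (a := a) (M := M [(i, 7), (i, 5), (j, 2), (j, 4), (j, 6), (i, 3)]) 5 7 9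
          6 8 10 rfl rfl rfl rfl rfl (mem_free_iff.2 ?_)))
        (lm_mem_Inv d q j (m := M [(i, 9), (j, 6), (j, 8), (j, 10), (i, 7), (i, 5), (j, 2), (j, 4),
          (j, 6), (i, 3)]) (mem_free_iff.2 ?_)) using 1
    · simp only [M, descend, List.map_cons, List.map_nil, List.sum_cons, List.sum_nil]
      abel_nf
    all_goals
      simp only [M, descend, map_sub, comp_Az_self _ _ hcj, comp_Yz_of_ne _ _ hij,
        comp_Az_of_eq_neg_three _ _ hij hCji, Int.reduceAdd, Int.reduceSub, Int.reduceNeg] <;> abel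

end RankTwo

/-! ### The Weyl group -/

section Weyl

variable {b : P.Base}

lemma weylGroup_ext {w w' : P.weylGroup} (h : ∀ x : V, w • x = w' • x) : w = w' :=
  Subtype.ext (RootPairing.Equiv.weightHom_injective P (LinearEquiv.ext h))

/-- The roots span `V`, so the permutation action on them is faithful. -/
lemma finite_weylGroup [P.IsRootSystem] [Finite ι] : Finite P.weylGroup := by
  refine Finite.of_injective (P.weylGroupToPerm) fun w w' h => weylGroup_ext fun x => ?_
  have hx : x ∈ Submodule.span K (Set.range P.root) := by
    rw [RootPairing.IsRootSystem.span_root_eq_top]; trivial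
  induction hx using Submodule.span_induction with
  | mem x hx =>
    obtain ⟨i, rfl⟩ := hx
    rw [RootPairing.weylGroup_apply_root, RootPairing.weylGroup_apply_root, h]
  | zero => rw [smul_zero, smul_zero]
  | add x y _ _ hx hy => rw [smul_add, smul_add, hx, hy]
  | smul c x _ hx => rw [smul_comm, smul_comm w' c x, hx]

lemma ofIdx_reflectionPerm (i j : ι) :
    RootPairing.weylGroup.ofIdx P (P.reflectionPerm j i) = RootPairing.weylGroup.ofIdx P j *
      RootPairing.weylGroup.ofIdx P i * RootPairing.weylGroup.ofIdx P j := by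
  refine weylGroup_ext fun x => ?_
  simp only [mul_smul, RootPairing.weylGroup.ofIdx_smul, RootPairing.Equiv.reflection_smul,
    RootPairing.reflection_reflectionPerm]
  rfl

lemma closure_simpleReflection [P.IsCrystallographic] [P.IsReduced] [Finite ι] (b : P.Base) :
    Subgroup.closure (Set.range (simpleReflection b)) = ⊤ := by
  have hidx : ∀ i, RootPairing.weylGroup.ofIdx P i ∈
      Subgroup.closure (Set.range (simpleReflection b)) := by
    intro i
    refine b.induction_reflect (p := fun i => RootPairing.weylGroup.ofIdx P i ∈
      Subgroup.closure (Set.range (simpleReflection b))) i (fun i hi => ?_) (fun i hi => ?_)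
      fun i j hi hj => ?_
    · rw [ofIdx_reflectionPerm]
      exact mul_mem (mul_mem hi hi) hi
    · exact Subgroup.subset_closure ⟨⟨i, hi⟩, rfl⟩
    · have hj' : RootPairing.weylGroup.ofIdx P j ∈
        Subgroup.closure (Set.range (simpleReflection b)) :=
        Subgroup.subset_closure ⟨⟨j, hj⟩, rfl⟩
      rw [ofIdx_reflectionPerm]
      exact mul_mem (mul_mem hj' hi) hj'
  rw [eq_top_iff]
  rintro ⟨w, hw⟩ -
  induction hw using RootPairing.weylGroup.induction with
  | mem i => exact hidx i
  | one => exact one_mem _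
  | mul x y hx hy hx' hy' => exact mul_mem hx' hy'

/-- The product `s_i s_j s_i ⋯` with `n` factors. -/
def altProd (i j : b.support) : ℕ → P.weylGroup
  | 0 => 1
  | n + 1 => simpleReflection b i * altProd j i n

variable [P.IsCrystallographic]

lemma simpleReflection_smul_add_left (i j : b.support) (x : V) (s t : K) :
    simpleReflection b i • (x + s • P.root i + t • P.root j) =
      x + (-s - P.toLinearMap x (P.coroot i) - t * (cartan b i j : K)) • P.root i +
        t • P.root j := by
  rw [smul_add, smul_add, smul_comm _ s, smul_comm _ t, simpleReflection_smul_self,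
    simpleReflection_smul, simpleReflection_smul_root, ← Int.cast_smul_eq_zsmul K]
  module

lemma simpleReflection_smul_add_right (i j : b.support) (x : V) (s t : K) :
    simpleReflection b j • (x + s • P.root i + t • P.root j) =
      x + s • P.root i +
        (-t - P.toLinearMap x (P.coroot j) - s * (cartan b j i : K)) • P.root j := by
  rw [add_right_comm, simpleReflection_smul_add_left, add_right_comm]

/-- Applied to `x`, both words give `x` plus a combination of $\alpha_i$ and $\alpha_j$. The
coefficients are polynomials in the two pairings of `x` with the simple coroots, and they agree
identically. -/
lemma altProd_comm (i j : b.support) {n : ℕ}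
    (h : cartan b i j = 0 ∧ cartan b j i = 0 ∧ n = 2 ∨
      cartan b i j = -1 ∧ cartan b j i = -1 ∧ n = 3 ∨
      cartan b i j = -1 ∧ cartan b j i = -2 ∧ n = 4 ∨
      cartan b i j = -1 ∧ cartan b j i = -3 ∧ n = 6) :
    altProd i j n = altProd j i n := by
  refine weylGroup_ext fun x => ?_
  have h0 : x = x + (0 : K) • P.root i + (0 : K) • P.root j := by simp
  rcases h with ⟨h1, h2, rfl⟩ | ⟨h1, h2, rfl⟩ | ⟨h1, h2, rfl⟩ | ⟨h1, h2, rfl⟩ <;>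
  · rw [h0]
    simp only [altProd, mul_smul, one_smul, simpleReflection_smul_add_left,
      simpleReflection_smul_add_right, h1, h2, Int.cast_neg, Int.cast_one, Int.cast_ofNat,
      Int.cast_zero]
    refine congrArg₂ (· + ·) (congrArg₂ (· + ·) rfl (congrArg (· • P.root i) ?_))
      (congrArg (· • P.root j) ?_) <;> ring

end Weyl

/-! ### Classification of pairs of simple roots -/

section Pairs

variable {b : P.Base} [P.IsRootSystem] [P.IsCrystallographic] [Finite ι] [P.IsReduced]

lemma cartan_pair_mem {i j : b.support} (hij : i ≠ j) :
    (cartan b i j, cartan b j i) ∈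
      ({(0, 0), (-1, -1), (-1, -2), (-2, -1), (-1, -3), (-3, -1)} : Set (ℤ × ℤ)) := by
  have h1 : cartan b i j ∈ ({-3, -2, -1, 0} : Set ℤ) := b.cartanMatrix_mem_of_ne hij.symm
  have h2 : cartan b j i ∈ ({-3, -2, -1, 0} : Set ℤ) := b.cartanMatrix_mem_of_ne hij
  have h3 := P.pairingIn_pairingIn_mem_set_of_isCrystal_of_isRed' (i := j) (j := i)
    (fun h => hij (Subtype.ext (P.root.injective h.symm)))
    (b.root_ne_neg_of_ne j.2 i.2 (fun h => hij (Subtype.ext h.symm)))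
  change (cartan b i j, cartan b j i) ∈ _ at h3
  generalize cartan b i j = x at *
  generalize cartan b j i = y at *
  simp only [Set.mem_insert_iff, Set.mem_singleton_iff, Prod.mk.injEq] at *
  omega

variable [P.IsIrreducible] {d : b.support → ℕ} (hd : IsSymmetrizer b d)

include hd

/-- The $d_i$ are proportional to the squared root lengths: this holds across each edge of the
Dynkin diagram, hence everywhere by connectedness. -/
lemma symmetrizer_mul_form (B : P.InvariantForm) (i j : b.support) :
    (d i : K) * B.form (P.root j) (P.root j) = d j * B.form (P.root i) (P.root i) := by
  refine b.induction_on_cartanMatrix (i := i)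
    (fun j => (d i : K) * B.form (P.root j) (P.root j) = d j * B.form (P.root i) (P.root i))
    rfl fun k l hk hkl => ?_
  have hC : ∀ k l : b.support, P.pairing k l = (cartan b l k : K) := fun k l => by
    have := P.algebraMap_pairingIn ℤ k l
    simpa [cartan] using this.symm
  have h1 := B.pairing_mul_eq_pairing_mul_swap k l
  rw [hC, hC] at h1
  have h2 : (d k : K) * cartan b k l = d l * cartan b l k := by
    exact_mod_cast hd.symm k l
  have h3 : (cartan b k l : K) ≠ 0 := Int.cast_ne_zero.2 hkl
  have h4 : (d k : K) ≠ 0 := Nat.cast_ne_zero.2 (hd.pos k).ne'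
  refine mul_left_cancel₀ (mul_ne_zero h3 h4) ?_
  linear_combination (d i : K) * B.form (P.root l) (P.root l) * h2 - (d i : K) * d l * h1 +
    (cartan b k l : K) * d l * hk

/-- An irreducible system has at most two root lengths, and a multiple bond exhibits both. Hence
every $d_k$ equals $d_i=n\,d_j$ or $d_j$, all are divisible by $d_j$, and coprimality forces
$d_j=1$. -/
lemma symmetrizer_of_multiple {i j : b.support} {n : ℕ} (hn : 1 < n)
    (hji : cartan b j i = -n) (hij : cartan b i j = -1) : d j = 1 ∧ d i = n := by
  have h1 : d i = n * d j := by
    have := hd.symm i j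
    rw [hij, hji] at this
    have h2 : (d i : ℤ) = n * d j := by linarith
    exact_mod_cast h2
  suffices h : d j = 1 by rw [h1, h, mul_one]; exact ⟨rfl, rfl⟩
  have := Fintype.ofFinite ι
  have B := (P.posRootForm ℤ).toInvariantForm
  have hB := symmetrizer_mul_form hd B
  have hBi : B.form (P.root i) (P.root i) ≠ 0 := B.ne_zero _
  have hBj : B.form (P.root j) (P.root j) ≠ 0 := B.ne_zero _
  have hdj : (d j : K) ≠ 0 := Nat.cast_ne_zero.2 (hd.pos j).ne'
  have hii : B.form (P.root i) (P.root i) = n * B.form (P.root j) (P.root j) := by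
    have h2 := hB i j
    rw [h1] at h2
    refine mul_left_cancel₀ hdj ?_
    rw [← h2]; push_cast; ring
  have hne : B.form (P.root i) (P.root i) ≠ B.form (P.root j) (P.root j) := by
    rw [hii]
    intro h
    have h3 : (n : K) = 1 := mul_right_cancel₀ hBj (h.trans (one_mul _).symm)
    have : n = 1 := by exact_mod_cast h3
    omega
  have hdvd : ∀ k, d j ∣ d k := by
    intro k
    rcases B.apply_eq_or_of_apply_ne hne k with h | h
    · have h2 := hB i k
      rw [h] at h2
      have : d i = d k := by exact_mod_cast mul_right_cancel₀ hBi h2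
      exact ⟨n, by rw [← this, h1, mul_comm]⟩
    · have h2 := hB j k
      rw [h] at h2
      have : d j = d k := by exact_mod_cast mul_right_cancel₀ hBj h2
      rw [this]
  have := Finset.dvd_gcd (s := Finset.univ) (f := d) (a := d j) fun k _ => hdvd k
  rw [hd.coprime] at this
  exact Nat.dvd_one.1 this

lemma hasInvariant (q : ℂˣ) {i j : b.support} (hij : i ≠ j) (a : ℂˣ) :
    HasInvariant d q i j a := by
  have hmem := cartan_pair_mem hij
  simp only [Set.mem_insert_iff, Set.mem_singleton_iff, Prod.mk.injEq] at hmem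
  rcases hmem with ⟨h, h'⟩ | ⟨h, h'⟩ | ⟨h, h'⟩ | ⟨h, h'⟩ | ⟨h, h'⟩ | ⟨h, h'⟩
  · exact hasInvariant_of_orthogonal hij h' a
  · refine hasInvariant_of_simply_laced hij h' h ?_ a
    have := hd.symm i j
    rw [h, h'] at this
    omega
  · obtain ⟨h1, h2⟩ := symmetrizer_of_multiple hd (n := 2) one_lt_two h' h
    exact hasInvariant_of_double_long hij h' h h2 h1 a
  · obtain ⟨h1, h2⟩ := symmetrizer_of_multiple hd (n := 2) one_lt_two h h'
    exact hasInvariant_of_double_short hij h' h h1 h2 a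
  · obtain ⟨h1, h2⟩ := symmetrizer_of_multiple hd (n := 3) (by norm_num) h' h
    exact hasInvariant_of_triple_long hij h' h h2 h1 a
  · obtain ⟨h1, h2⟩ := symmetrizer_of_multiple hd (n := 3) (by norm_num) h h'
    exact hasInvariant_of_triple_short hij h' h h1 h2 a

end Pairs

/-! ### Descending paths -/

section Paths

open Completion

variable {b : P.Base} [P.IsRootSystem] [P.IsCrystallographic] [Finite ι]

/-- The isomorphisms obtained by composing operators `Θ_i`, `i ∈ S`, along a path from `u` to `v`
that descends at each step. -/
inductive IsDown (d : b.support → ℕ) (q : ℂˣ) (S : Set b.support) :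
    ∀ u v : P.weylGroup, (Completion b u ≃+* Completion b v) → Prop
  | refl (u : P.weylGroup) : IsDown d q S u u (RingEquiv.refl _)
  | step {u u' v : P.weylGroup} (i : b.support) (hi : i ∈ S)
      (h : u' = u * simpleReflection b i) (hu : u • P.root i ∉ posCone b)
      (f : Completion b u' ≃+* Completion b v) (hf : IsDown d q S u' v f) :
      IsDown d q S u v ((thetaEquiv d q i h).trans f)

variable {d : b.support → ℕ} {q : ℂˣ} {S : Set b.support} {u v : P.weylGroup}
  {f : Completion b u ≃+* Completion b v}

lemma IsDown.mono {S' : Set b.support} (h : IsDown d q S u v f) (hS : S ⊆ S') :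
    IsDown d q S' u v f := by
  induction h with
  | refl u => exact .refl u
  | step i hi h hu f _ ih => exact .step i (hS hi) h hu f ih

lemma IsDown.isFiltered (h : IsDown d q S u v f) : IsFiltered f := by
  induction h with
  | refl u => exact .refl
  | step i hi h hu f _ ih => exact (isFiltered_thetaEquiv d q i h).trans ih

lemma IsDown.apply_invariant (h : IsDown d q S u v f) {p : Laurent b}
    (hp : ∀ i ∈ S, p ∈ Inv d q i) : f (ofLaurent u p) = ofLaurent v p := by
  induction h with
  | refl u => rfl
  | step i hi h hu f _ ih =>
    rw [RingEquiv.trans_apply, thetaEquiv_apply, hp i hi _ _ h, ih]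

lemma notMem_posCone_of_neg_mem {i : ι} (h : -(u • P.root i) ∈ posCone b) :
    u • P.root i ∉ posCone b :=
  fun h' => smul_root_ne_zero u i (posCone_antisymm b h' h)

lemma Deep.nsmul {x : V} (h : Deep b 1 x) (n : ℕ) : Deep b n (n • x) := by
  induction n with
  | zero => rw [zero_smul]; exact deep_zero_iff.2 (zero_mem _)
  | succ n ih => rw [succ_nsmul]; exact ih.add h

/-! ### Rank two -/

/-- Bookkeeping for an alternating descending path: `(x₁, x₂)` and `(y₁, y₂)` are the coordinates
of the images of the next and of the other simple root. -/
def AltDescends : ℕ → (p r x₁ x₂ y₁ y₂ : ℤ) → Prop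
  | 0, _, _, x₁, x₂, y₁, y₂ => 0 ≤ x₁ ∧ 0 ≤ x₂ ∧ 0 ≤ y₁ ∧ 0 ≤ y₂
  | n + 1, p, r, x₁, x₂, y₁, y₂ =>
    x₁ ≤ 0 ∧ x₂ ≤ 0 ∧ AltDescends n r p (y₁ - p * x₁) (y₂ - p * x₂) (-x₁) (-x₂)

lemma zsmul_add_zsmul_mem {x y : V} (hx : x ∈ posCone b) (hy : y ∈ posCone b) {m n : ℤ}
    (hm : 0 ≤ m) (hn : 0 ≤ n) : m • x + n • y ∈ posCone b := by
  lift m to ℕ using hm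
  lift n to ℕ using hn
  rw [natCast_zsmul, natCast_zsmul]
  exact add_mem (nsmul_mem hx _) (nsmul_mem hy _)

/-- The images of the two simple roots stay in the plane of `x` and `y`, so whether each step
descends is read off from integer coordinates, updated by $s_i\alpha_j=\alpha_j-C_{i,j}\alpha_i$.
For concrete Cartan entries the condition is then a numerical check. -/
lemma exists_isDown_altProd {x y : V} (hx : x ∈ posCone b) (hy : y ∈ posCone b) (n : ℕ)
    {i j : b.support} (hi : i ∈ S) (hj : j ∈ S) {x₁ x₂ y₁ y₂ : ℤ} {u : P.weylGroup}
    (h : AltDescends n (cartan b i j) (cartan b j i) x₁ x₂ y₁ y₂)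
    (hui : u • P.root i = x₁ • x + x₂ • y) (huj : u • P.root j = y₁ • x + y₂ • y) :
    (∃ f, IsDown d q S u (u * altProd i j n) f) ∧
      (u * altProd i j n) • P.root i ∈ posCone b ∧
      (u * altProd i j n) • P.root j ∈ posCone b := by
  induction n generalizing i j x₁ x₂ y₁ y₂ u with
  | zero =>
    obtain ⟨h1, h2, h3, h4⟩ := h
    rw [altProd, mul_one, hui, huj]
    exact ⟨⟨_, .refl u⟩, zsmul_add_zsmul_mem hx hy h1 h2, zsmul_add_zsmul_mem hx hy h3 h4⟩
  | succ n ih =>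
    obtain ⟨h1, h2, h⟩ := h
    have hneg : u • P.root i ∉ posCone b := by
      refine notMem_posCone_of_neg_mem ?_
      rw [hui, neg_add, ← neg_smul, ← neg_smul]
      exact zsmul_add_zsmul_mem hx hy (by omega) (by omega)
    obtain ⟨⟨f, hf⟩, hpj, hpi⟩ := ih (u := u * simpleReflection b i) hj hi h
      (by
        rw [mul_smul, simpleReflection_smul_root, smul_sub, smul_comm u (cartan b i j), hui, huj]
        module)
      (by
        rw [mul_smul, simpleReflection_smul_self, smul_neg, hui]
        module)
    rw [altProd, ← mul_assoc]
    exact ⟨⟨_, .step i hi rfl hneg f hf⟩, hpi, hpj⟩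

/-- The diamond property: two descents from `u` can be completed to descending paths with the same
composite. -/
lemma exists_diamond [P.IsReduced] [P.IsIrreducible] (hd : IsSymmetrizer b d) {i j : b.support}
    (hij : i ≠ j) {u u₁ u₂ : P.weylGroup} (h₁ : u₁ = u * simpleReflection b i)
    (h₂ : u₂ = u * simpleReflection b j) (hui : u • P.root i ∉ posCone b)
    (huj : u • P.root j ∉ posCone b) :
    ∃ (v : P.weylGroup) (f : Completion b u₁ ≃+* Completion b v)
      (g : Completion b u₂ ≃+* Completion b v), IsDown d q Set.univ u₁ v f ∧
      IsDown d q Set.univ u₂ v g ∧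
      (thetaEquiv d q i h₁).trans f = (thetaEquiv d q j h₂).trans g := by
  have hx := neg_smul_root_mem b u i hui
  have hy := neg_smul_root_mem b u j huj
  -- The length `n + 1` is 2, 3, 4 or 6, according to the bond. Coordinates refer to the positive
  -- vectors $-u\alpha_i$ and $-u\alpha_j$, hence the initial values $(-1,0)$ and $(0,-1)$.
  obtain ⟨n, hcomm, hn1, hn2⟩ : ∃ n, altProd i j (n + 1) = altProd j i (n + 1) ∧
      AltDescends (n + 1) (cartan b i j) (cartan b j i) (-1) 0 0 (-1) ∧
      AltDescends (n + 1) (cartan b j i) (cartan b i j) (-1) 0 0 (-1) := by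
    have hmem := cartan_pair_mem hij
    simp only [Set.mem_insert_iff, Set.mem_singleton_iff, Prod.mk.injEq] at hmem
    rcases hmem with ⟨h, h'⟩ | ⟨h, h'⟩ | ⟨h, h'⟩ | ⟨h, h'⟩ | ⟨h, h'⟩ | ⟨h, h'⟩
    · exact ⟨1, altProd_comm i j (by simp [h, h']), by simp [AltDescends, h, h'],
        by simp [AltDescends, h, h']⟩
    · exact ⟨2, altProd_comm i j (by simp [h, h']), by simp [AltDescends, h, h'],
        by simp [AltDescends, h, h']⟩
    · exact ⟨3, altProd_comm i j (by simp [h, h']), by simp [AltDescends, h, h'],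
        by simp [AltDescends, h, h']⟩
    · exact ⟨3, (altProd_comm j i (by simp [h, h'])).symm, by simp [AltDescends, h, h'],
        by simp [AltDescends, h, h']⟩
    · exact ⟨5, altProd_comm i j (by simp [h, h']), by simp [AltDescends, h, h'],
        by simp [AltDescends, h, h']⟩
    · exact ⟨5, (altProd_comm j i (by simp [h, h'])).symm, by simp [AltDescends, h, h'],
        by simp [AltDescends, h, h']⟩
  obtain ⟨-, -, hn1⟩ := hn1
  obtain ⟨-, -, hn2⟩ := hn2
  let S : Set b.support := {i, j}
  have hiS : i ∈ S := Or.inl rfl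
  have hjS : j ∈ S := Or.inr rfl
  have key : ∀ {i j : b.support}, i ∈ S → j ∈ S → -(u • P.root i) ∈ posCone b →
      -(u • P.root j) ∈ posCone b →
      AltDescends n (cartan b j i) (cartan b i j) (0 - cartan b i j * -1) (-1 - cartan b i j * 0)
        (-(-1)) (-0) → ∀ {u'}, u' = u * simpleReflection b i →
      (∃ f, IsDown d q S u' (u * altProd i j (n + 1)) f) ∧
      (u * altProd i j (n + 1)) • P.root j ∈ posCone b ∧
      (u * altProd i j (n + 1)) • P.root i ∈ posCone b := by
    rintro i j hi hj hx hy hn u' rfl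
    rw [altProd, ← mul_assoc]
    refine exists_isDown_altProd hx hy n hj hi hn ?_ ?_
    · rw [mul_smul, simpleReflection_smul_root, smul_sub, smul_comm u (cartan b i j)]
      generalize u • P.root i = X
      generalize u • P.root j = Y
      module
    · rw [mul_smul, simpleReflection_smul_self, smul_neg]
      generalize u • P.root i = X
      generalize u • P.root j = Y
      module
  have key₁ := key hiS hjS hx hy hn1 h₁
  rw [hcomm] at key₁
  obtain ⟨⟨f, hf⟩, hvj, hvi⟩ := key₁
  obtain ⟨⟨g, hg⟩, -, -⟩ := key hjS hiS hy hx hn2 h₂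
  refine ⟨_, f, g, hf.mono (Set.subset_univ _), hg.mono (Set.subset_univ _), ?_⟩
  have hF : IsDown d q S u _ ((thetaEquiv d q i h₁).trans f) := .step i hiS h₁ hui f hf
  have hG : IsDown d q S u _ ((thetaEquiv d q j h₂).trans g) := .step j hjS h₂ huj g hg
  generalize (thetaEquiv d q i h₁).trans f = F at hF
  generalize (thetaEquiv d q j h₂).trans g = G at hG
  generalize u * altProd j i (n + 1) = v at *
  -- The inverses are compared because their source is the completion at `v`, where both simple
  -- roots have positive image and the common invariants have leading monomial $Y_{i,a}$ or
  -- $Y_{j,a}$.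
  have hsymm : F.symm.toRingHom = G.symm.toRingHom := by
    have hinv : ∀ p, p ∈ Inv d q i → p ∈ Inv d q j →
        F.symm (ofLaurent v p) = G.symm (ofLaurent v p) := by
      intro p hpi hpj
      have hp : ∀ k ∈ S, p ∈ Inv d q k := by
        rintro k (rfl | rfl)
        · exact hpi
        · exact hpj
      rw [← hF.apply_invariant hp, F.symm_apply_apply, hF.apply_invariant hp,
        ← hG.apply_invariant hp, G.symm_apply_apply]
    have hdeep : ∀ {m₀ m : Monomial b}, Below i j m₀ m →
        Deep b 1 (twt b v m₀ - twt b v m) := by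
      rintro m₀ m ⟨k, k', hk, h⟩
      rw [twt_apply, twt_apply, ← smul_sub, h, smul_add, smul_comm v k, smul_comm v k']
      exact (((deep_one_of_mem hvi (smul_root_ne_zero v _)).nsmul k).add
        ((deep_one_of_mem hvj (smul_root_ne_zero v _)).nsmul k')).mono hk
    refine ringHom_eq_of_leading (G := Set.range fun p : b.support × ℂˣ => Y p.1 p.2)
      hF.isFiltered.continuous_symm hG.isFiltered.continuous_symm
      (fun m => hF.isFiltered.symm_mem_filt _ _ _ (monomial_mem_filt m))
      (fun m => hG.isFiltered.symm_mem_filt _ _ _ (monomial_mem_filt m))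
      (fun H hH => mem_of_forall_Y_mem fun k a => hH ⟨(k, a), rfl⟩) ?_
    rintro _ ⟨⟨k, a⟩, rfl⟩
    by_cases hki : k = i
    · obtain ⟨l, hl1, hl2, hl⟩ := hasInvariant hd q hij a
      rw [hki]
      exact ⟨l, fun m hm => hdeep (hl m hm), hinv _ hl1 hl2⟩
    by_cases hkj : k = j
    · obtain ⟨l, hl1, hl2, hl⟩ := hasInvariant hd q (Ne.symm hij) a
      rw [hkj]
      exact ⟨l, fun m hm => hdeep (hl m hm).swap, hinv _ hl2 hl1⟩
    · refine ⟨[], by simp, hinv _ ?_ ?_⟩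
      · simpa using lm_mem_Inv d q i (Y_mem_free hki a)
      · simpa using lm_mem_Inv d q j (Y_mem_free hkj a)
  have : F.symm = G.symm := RingEquiv.ext fun x => RingHom.congr_fun hsymm x
  rw [← F.symm_symm, this, G.symm_symm]

/-! ### Normal forms -/

variable (b) in
/-- The sum of the fundamental weights. -/
def rho : V := ∑ i, fundamentalWeight b i

lemma simpleReflection_smul_rho (i : b.support) :
    simpleReflection b i • rho b = rho b - P.root i := by
  simp [rho, Finset.smul_sum, simpleReflection_smul_fundamentalWeight, Finset.sum_sub_distrib]

lemma not_deep_one_zero : ¬ Deep b 1 (0 : V) := by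
  rintro ⟨k, hk, h⟩
  have : k = 0 := rootSum_injective b (by rw [hk, map_zero])
  simp [this] at h

/-- Induction along descents. -/
lemma descent_induction {p : P.weylGroup → Prop}
    (h : ∀ u, (∀ i : b.support, u • P.root i ∉ posCone b → p (u * simpleReflection b i)) → p u)
    (u : P.weylGroup) : p u := by
  -- The position of $u\rho$ in the dominance order replaces the length function: a descent
  -- $u\mapsto us_i$ raises it by the positive root $-u\alpha_i$, and $W$ is finite.
  let r : P.weylGroup → P.weylGroup → Prop := fun u' u => Deep b 1 (u' • rho b - u • rho b)
  have : IsTrans _ r := ⟨fun x y z hxy hyz => by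
    have := Deep.add hxy hyz
    rw [sub_add_sub_cancel] at this
    exact this.mono one_le_two⟩
  have : Std.Irrefl r := ⟨fun x hx => not_deep_one_zero (by simpa [r] using hx)⟩
  have := finite_weylGroup (P := P)
  have hwf : WellFounded r := Finite.wellFounded_of_trans_of_irrefl r
  induction u using hwf.induction with
  | _ u ih =>
    refine h u fun i hi => ih _ ?_
    change Deep b 1 _
    rw [mul_smul, simpleReflection_smul_rho, smul_sub, sub_sub_cancel_left]
    exact deep_one_of_mem (neg_smul_root_mem b u i hi) (neg_ne_zero.2 (smul_root_ne_zero u _))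

/-- The pair of an element `v` and an isomorphism `𝒴̃^u → 𝒴̃^v`. -/
abbrev Arrow (b : P.Base) (u : P.weylGroup) : Type _ :=
  Σ v : P.weylGroup, Completion b u ≃+* Completion b v

/-- Arrows given by descending paths that cannot be continued. -/
def IsNormalForm (d : b.support → ℕ) (q : ℂˣ) (u : P.weylGroup) (F : Arrow b u) : Prop :=
  IsDown d q Set.univ u F.1 F.2 ∧ ∀ i : b.support, F.1 • P.root i ∈ posCone b

/-- Precomposition of an arrow with `Θ_i`. -/
def Arrow.cons (d : b.support → ℕ) (q : ℂˣ) (i : b.support) {u u' : P.weylGroup}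
    (h : u' = u * simpleReflection b i) (F : Arrow b u') : Arrow b u :=
  ⟨F.1, (thetaEquiv d q i h).trans F.2⟩

lemma IsNormalForm.cons {i : b.support} {u u' : P.weylGroup} {F : Arrow b u'}
    (hF : IsNormalForm d q u' F) (h : u' = u * simpleReflection b i)
    (hu : u • P.root i ∉ posCone b) : IsNormalForm d q u (F.cons d q i h) :=
  ⟨.step i (Set.mem_univ i) h hu _ hF.1, hF.2⟩

lemma exists_isNormalForm (d : b.support → ℕ) (q : ℂˣ) (u : P.weylGroup) :
    ∃ F, IsNormalForm d q u F := by
  refine descent_induction (b := b) (p := fun u => ∃ F, IsNormalForm d q u F) (fun u ih => ?_) u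
  by_cases hu : ∀ i : b.support, u • P.root i ∈ posCone b
  · exact ⟨⟨u, RingEquiv.refl _⟩, .refl u, hu⟩
  · push Not at hu
    obtain ⟨i, hi⟩ := hu
    obtain ⟨F, hF⟩ := ih i hi
    exact ⟨_, hF.cons rfl hi⟩

lemma IsDown.trans_isNormalForm (h : IsDown d q Set.univ u v f) {F : Arrow b v}
    (hF : IsNormalForm d q v F) : IsNormalForm d q u ⟨F.1, f.trans F.2⟩ := by
  induction h with
  | refl u => exact hF
  | step i hi h hu f _ ih => exact (ih hF).cons h hu

lemma isNormalForm_cases {F : Arrow b u} (hF : IsNormalForm d q u F) :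
    F = ⟨u, RingEquiv.refl _⟩ ∧ (∀ i : b.support, u • P.root i ∈ posCone b) ∨
      ∃ (i : b.support) (F' : Arrow b (u * simpleReflection b i)),
        u • P.root i ∉ posCone b ∧ IsNormalForm d q _ F' ∧ F = F'.cons d q i rfl := by
  obtain ⟨v, f⟩ := F
  obtain ⟨h, hmin⟩ := hF
  change IsDown d q Set.univ u v f at h
  change ∀ i : b.support, v • P.root i ∈ posCone b at hmin
  cases h with
  | refl => exact Or.inl ⟨rfl, hmin⟩
  | step i hi h hu g hg =>
    subst h
    exact Or.inr ⟨i, ⟨v, g⟩, hu, ⟨hg, hmin⟩, rfl⟩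

/-- Newman's lemma. If two maximal descending paths start with different steps, `exists_diamond`
joins these steps at some `v`. Any normal form at `v` continues both, and induction compares each
path with its continuation. Since an arrow includes its target, equality of endpoints is part of the
result. -/
lemma isNormalForm_unique [P.IsReduced] [P.IsIrreducible] (hd : IsSymmetrizer b d)
    (u : P.weylGroup) :
    ∀ F G : Arrow b u, IsNormalForm d q u F → IsNormalForm d q u G → F = G := by
  refine descent_induction (b := b) (p := fun u => ∀ F G : Arrow b u, IsNormalForm d q u F →
    IsNormalForm d q u G → F = G) (fun u ih => ?_) u
  intro F G hF hG
  rcases isNormalForm_cases hF with ⟨rfl, hmin⟩ | ⟨i, F', hi, hF', rfl⟩ <;>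
    rcases isNormalForm_cases hG with ⟨rfl, hmin'⟩ | ⟨j, G', hj, hG', rfl⟩
  · rfl
  · exact absurd (hmin j) hj
  · exact absurd (hmin' i) hi
  · by_cases hij : i = j
    · subst hij
      rw [ih i hi F' G' hF' hG']
    · obtain ⟨v, f, g, hf, hg, hfg⟩ := exists_diamond (q := q) hd hij rfl rfl hi hj
      obtain ⟨H, hH⟩ := exists_isNormalForm d q v
      rw [ih i hi F' _ hF' (hf.trans_isNormalForm hH),
        ih j hj G' _ hG' (hg.trans_isNormalForm hH)]
      exact congrArg (fun t => (⟨H.1, t.trans H.2⟩ : Arrow b u)) hfg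

lemma Arrow.cons_cons {i : b.support} {u u' : P.weylGroup}
    (h : u' = u * simpleReflection b i) (h' : u = u' * simpleReflection b i) (F : Arrow b u) :
    (F.cons d q i h').cons d q i h = F := by
  obtain ⟨v, f⟩ := F
  simp only [Arrow.cons]
  congr 1
  refine RingEquiv.ext fun x => ?_
  exact congrArg f ((thetaEquiv d q i h).symm_apply_apply x)

/-- A trivialization of the system of completions: isomorphisms with a fixed ring that are
compatible with the operators `Θ_i`. -/
theorem exists_trivialization [P.IsReduced] [P.IsIrreducible] (hd : IsSymmetrizer b d) (q : ℂˣ) :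
    ∃ (e : P.weylGroup) (Φ : ∀ u, Completion b u ≃+* Completion b e),
      ∀ (i : b.support) (u u' : P.weylGroup) (h : u' = u * simpleReflection b i),
        Φ u = (thetaEquiv d q i h).trans (Φ u') := by
  choose nf hnf using exists_isNormalForm (b := b) d q
  have hcons : ∀ (i : b.support) (u u' : P.weylGroup) (h : u' = u * simpleReflection b i),
      nf u = (nf u').cons d q i h := by
    intro i u u' h
    -- If $u\to us_i$ ascends, the reverse step descends and uniqueness applies there; involutivity
    -- of $\Theta_i$ turns the relation around.
    by_cases hu : u • P.root i ∈ posCone b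
    · have h' := eq_mul_simpleReflection i h
      have hu' : u' • P.root i ∉ posCone b := by
        refine notMem_posCone_of_neg_mem ?_
        rwa [h, mul_smul, simpleReflection_smul_self, smul_neg, neg_neg]
      rw [isNormalForm_unique hd u' _ _ (hnf u') ((hnf u).cons h' hu'), Arrow.cons_cons]
    · exact isNormalForm_unique hd u _ _ (hnf u) ((hnf u').cons h hu)
  -- Neighbours $u$ and $us_i$ have normal forms with the same endpoint, and the simple reflections
  -- connect all of $W$.
  have hconst : ∀ u, (nf u).1 = (nf 1).1 := by
    intro u
    have hu : u ∈ Subgroup.closure (Set.range (simpleReflection b)) := by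
      rw [closure_simpleReflection]; trivial
    induction hu using Subgroup.closure_induction_right with
    | one => rfl
    | mul_right x hx y hy ih =>
      obtain ⟨i, rfl⟩ := hy
      rw [← ih, hcons i x _ rfl]
      rfl
    | mul_inv_cancel x hx y hy ih =>
      obtain ⟨i, rfl⟩ := hy
      rw [← ih, hcons i x _ rfl, inv_eq_of_mul_eq_one_right (simpleReflection_mul_self i)]
      rfl
  have hex : ∀ u, ∃ f : Completion b u ≃+* Completion b (nf 1).1, nf u = ⟨_, f⟩ := by
    intro u
    have := hconst u
    generalize nf u = F at this
    obtain ⟨v, f⟩ := F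
    change v = _ at this
    subst this
    exact ⟨f, rfl⟩
  choose Φ hΦ using hex
  refine ⟨(nf 1).1, Φ, fun i u u' h => ?_⟩
  have := hcons i u u' h
  rw [hΦ u, hΦ u'] at this
  exact eq_of_heq (Sigma.mk.inj this).2

end Paths

/-! ### The operators on `Π` -/

section Operators

open Completion

variable {b : P.Base} [P.IsRootSystem] [P.IsCrystallographic] [Finite ι] (d : b.support → ℕ)
  (q : ℂˣ) (i : b.support)

/-- The operator `Θ_i` on `Π`. -/
def bigTheta : BigPi b →+* BigPi b :=
  RingHom.pi fun u => (theta d q i (mul_simpleReflection_cancel u i).symm).comp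
    (Pi.evalRingHom (fun w : P.weylGroup => Completion b w) (u * simpleReflection b i))

/-- The definition evaluates at $w's_i$, which equals `w` only propositionally; this lemma absorbs
the transport. -/
lemma bigTheta_apply (f : BigPi b) {w w' : P.weylGroup} (h : w' = w * simpleReflection b i) :
    bigTheta d q i f w' = theta d q i h (f w) := by
  have key : ∀ (v : P.weylGroup) (hv : w' = v * simpleReflection b i), v = w →
      theta d q i hv (f v) = theta d q i h (f w) := by
    rintro v hv rfl
    rfl
  exact key _ (mul_simpleReflection_cancel w' i).symm (eq_mul_simpleReflection i h).symm

lemma isTheta_bigTheta : IsTheta d q i (bigTheta d q i) := fun w =>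
  ⟨theta d q i rfl, isThetaComponent_theta d q i w, fun f => bigTheta_apply d q i f rfl⟩

lemma continuous_bigTheta : Continuous (bigTheta d q i) :=
  continuous_pi fun u =>
    (continuous_theta d q i (mul_simpleReflection_cancel u i).symm).comp (continuous_apply _)

/-- The action of `W` on a product of rings induced by isomorphisms with a fixed ring. -/
def transportAction {W R : Type*} {A : W → Type*} [Group W] [Ring R] [∀ u, Ring (A u)]
    (Φ : ∀ u, A u ≃+* R) : W →* RingAut (∀ u, A u) :=
  have key : ∀ (f : ∀ u, A u) {u v : W}, u = v → Φ u (f u) = Φ v (f v) := fun f u v h => by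
    subst h
    rfl
  MonoidHom.mk'
    (fun x =>
      { toFun := fun f u => (Φ u).symm (Φ (u * x) (f (u * x)))
        invFun := fun f u => (Φ u).symm (Φ (u * x⁻¹) (f (u * x⁻¹)))
        left_inv := fun f => funext fun u => by
          dsimp only
          rw [RingEquiv.apply_symm_apply, RingEquiv.symm_apply_eq]
          exact key f (inv_mul_cancel_right u x)
        right_inv := fun f => funext fun u => by
          dsimp only
          rw [RingEquiv.apply_symm_apply, RingEquiv.symm_apply_eq]
          exact key f (mul_inv_cancel_right u x)
        map_mul' := fun f g => funext fun u => by simp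
        map_add' := fun f g => funext fun u => by simp })
    (fun x y => RingEquiv.ext fun f => funext fun u => by
      change (Φ u).symm (Φ (u * (x * y)) (f (u * (x * y)))) =
        (Φ u).symm (Φ (u * x) ((Φ (u * x)).symm (Φ (u * x * y) (f (u * x * y)))))
      rw [RingEquiv.apply_symm_apply, key f (mul_assoc u x y)])

lemma transportAction_apply {W R : Type*} {A : W → Type*} [Group W] [Ring R] [∀ u, Ring (A u)]
    (Φ : ∀ u, A u ≃+* R) (x : W) (f : ∀ u, A u) (u : W) :
    transportAction Φ x f u = (Φ u).symm (Φ (u * x) (f (u * x))) := rfl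

variable {d}

/-- Under the trivialization an element of $\Pi$ becomes a function from $W$ to a fixed ring, and
$W$ acts by right translation of the argument. Compatibility of `Φ` with $\Theta_i$ says exactly
that $s_i$ acts as `bigTheta`. -/
theorem existsUnique_action [P.IsReduced] [P.IsIrreducible] (hd : IsSymmetrizer b d) :
    ∃! ρ : P.weylGroup →* RingAut (BigPi b),
      ∀ (i : b.support) (f : BigPi b), ρ (simpleReflection b i) f = bigTheta d q i f := by
  obtain ⟨e, Φ, hΦ⟩ := exists_trivialization hd q
  refine ⟨transportAction Φ, fun i f => funext fun u => ?_, fun ρ hρ => ?_⟩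
  · rw [transportAction_apply, RingEquiv.symm_apply_eq,
      hΦ i _ _ (mul_simpleReflection_cancel u i).symm]
    rfl
  · refine MonoidHom.eq_of_eqOn_dense (closure_simpleReflection b) ?_
    rintro _ ⟨i, rfl⟩
    refine RingEquiv.ext fun f => ?_
    rw [hρ i f]
    funext u
    rw [transportAction_apply, eq_comm, RingEquiv.symm_apply_eq,
      hΦ i _ _ (mul_simpleReflection_cancel u i).symm]
    rfl

end Operators

end QCharacter

end

theorem theorem3p5 {ι K V V' : Type*} [Finite ι] [Field K] [CharZero K]
    [AddCommGroup V] [Module K V] [AddCommGroup V'] [Module K V']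
    (P : RootPairing ι K V V') [P.IsRootSystem] [P.IsCrystallographic] [P.IsReduced]
    [P.IsIrreducible] (b : P.Base)
    (d : b.support → ℕ) (hd : QCharacter.IsSymmetrizer b d)
    (q : ℂˣ) (hq : ∀ n : ℕ, 0 < n → q ^ n ≠ 1) :
    (∀ (w : P.weylGroup) (i : b.support) (a : ℂˣ), IsUnit (QCharacter.Sigma d q w i a)) ∧
    (∀ (w : P.weylGroup) (i : b.support), ∃! T, QCharacter.IsThetaComponent d q w i T) ∧
    ∃ Θ : b.support → QCharacter.BigPi b →+* QCharacter.BigPi b,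
      (∀ i, QCharacter.IsTheta d q i (Θ i)) ∧
      (∀ i, Continuous (Θ i)) ∧
      ∃! ρ : P.weylGroup →* RingAut (QCharacter.BigPi b),
        ∀ (i : b.support) (f : QCharacter.BigPi b),
          ρ (QCharacter.simpleReflection b i) f = Θ i f :=
  ⟨fun w i a => QCharacter.isUnit_Sigma d q w i a,
    fun w i => ⟨QCharacter.theta d q i rfl, QCharacter.isThetaComponent_theta d q i w,
      fun _ hT => QCharacter.isThetaComponent_unique d q i hT
        (QCharacter.isThetaComponent_theta d q i w)⟩,
    QCharacter.bigTheta d q, QCharacter.isTheta_bigTheta d q,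
    QCharacter.continuous_bigTheta d q, QCharacter.existsUnique_action q hd⟩
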